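/- Let $k\ge 2$. A hypergraph $(H,E)$ of arity $k$, $E\subseteq H^k$, is called $k$-full if $E$ is symmetric and contains every $k$-tuple with a repeated entry. A template of arity $k$ is a sequence $\mathcal H=\langle \mathbf h_n=(H_n,E_n):n<\omega\rangle$ of finite $k$-full hypergraphs, with vertex set $\{0,\dots,H_n-1\}$, for which there is a function $f:\omega\to\omega\setminus\{0\}$ with $\lim_n f(n)=\infty$, $f(n)\le H_n$ for all $n$, and the extension property: for every $n$ and any $t=f(n)$ many $(k-1)$-tuples $(i^\ell_0,\dots,i^\ell_{k-2})$, $\ell<t$, from $H_n$, there is $s\in H_n$ with $(s,i^\ell_0,\dots,i^\ell_{k-2})\in E_n$ for all $\ell<t$. Let $X_{\mathcal H}$ be the set of finite sequences $\eta$ of natural numbers with $\eta(n)<H_n$ for all $n<\operatorname{lgn}(\eta)$. Let $\mathcal L$ be the language with a $k$-place relation $R$ and unary predicates $Q_\eta$ ($\eta\in X_{\mathcal H}$), and let $T_0=T_0(\mathcal H)$ be the universal $\mathcal L$-theory which says that * $R$ is symmetric and holds only on tuples of distinct elements; * $Q_{\langle\rangle}$ holds of everything, and $Q_\nu\subseteq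 Q_\eta$ whenever $\eta$ is an initial segment of $\nu$; * for every $\eta$ of length $m$, the predicates $Q_{\eta^\frown\langle i\rangle}$, $i<H_m$, are pairwise disjoint and cover $Q_\eta$; * whenever $\eta_0,\dots,\eta_{k-1}\in X_{\mathcal H}$, $n<\min_i\operatorname{lgn}(\eta_i)$ and $(\eta_0(n),\dots,\eta_{k-1}(n))\notin E_n$, there is no $R$-edge $(x_0,\dots,x_{k-1})$ with $x_i\in Q_{\eta_i}$ for all $i<k$. For $m<\omega$ let $\mathcal L_m\subseteq\mathcal L$ consist of $R$ and the $Q_\eta$ with $\operatorname{lgn}(\eta)\le m$, and let $T_0^m$ be the restriction of $T_0$ to $\mathcal L_m$, i.e. the axioms of $T_0$ in this language. A theory $T'\supseteq T_0'$ in the same language (containment up to consequences) is a model completion of $T_0'$ if for every model $M$ of $T_0'$ the theory $T'\cup\operatorname{Diag}(M)$ is complete (and consistent), where $\operatorname{Diag}(M)$ is the quantifier-free diagram of $M$. **Theorem.** For every template $\mathcal H$ of arity $k\geq 2$, the theory $T_0(\mathcal H)$ has a model completion $T=T(\mathcal H)$, which is unique up to logical equivalence. $T$ eliminates quantifiers,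 $T$ is simple (no formula has the tree property), and $T$ has rank $1$ (the maximum of the $SU$-ranks of complete $1$-types over $\emptyset$ is $1$). Moreover, each $T_0^m$ has a model completion $T^m$, and $T$ is the limit of $\langle T^m:m<\omega\rangle$: for every $\mathcal L$-sentence $\varphi$, for all sufficiently large $m$, $\varphi$ is an $\mathcal L_m$-sentence and $T^m\vdash\varphi$ if and only if $T\vdash\varphi$. -/

import Mathlib

open FirstOrder Filter

universe u v w

/-! ### General model theory -/

namespace FirstOrder.Language

variable (L : Language.{u, v})

/-- The (quantifier-free) diagram of a structure `M`, with the elements of `M` as new constants. -/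
def qfDiagram (M : Type w) [L.Structure M] : L[[M]].Theory :=
  {φ | BoundedFormula.IsQF φ ∧ M ⊨ φ}

/-- The tuples `c` and `d` have the same type over the parameter set `A`. -/
def SameTypeOver {N : Type w} [L.Structure N] (A : Set N) {β : Type} (c d : β → N) : Prop :=
  ∀ θ : L.Formula (A ⊕ β),
    θ.Realize (Sum.elim (fun a : A => (a : N)) c) ↔ θ.Realize (Sum.elim (fun a : A => (a : N)) d)

/-- The formula `φ(x̄, d)` divides over `A`: in some elementary extension there are infinitely many
realizations `c i` of `tp(d / A)` such that the family `φ(x̄, c i)` is `q`-inconsistent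
for some finite `q`. -/
def Divides {N : Type w} [L.Structure N] {a b : ℕ} (A : Set N)
    (φ : L.Formula (Fin a ⊕ Fin b)) (d : Fin b → N) : Prop :=
  ∃ (N' : Type w) (_ : L.Structure N') (g : N ↪ₑ[L] N') (q : ℕ) (c : ℕ → Fin b → N'),
    (∀ i, L.SameTypeOver (g '' A) (c i) (g ∘ d)) ∧
    ∀ s : Finset ℕ, s.card = q →
      ¬ ∃ x : Fin a → N', ∀ i ∈ s, φ.Realize (Sum.elim x (c i))

/-- The formula `φ(x̄, d)` forks over `A`: in some elementary extension it implies a finite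
disjunction of formulas each of which divides over `A`. -/
def Forks {N : Type w} [L.Structure N] {a b : ℕ} (A : Set N)
    (φ : L.Formula (Fin a ⊕ Fin b)) (d : Fin b → N) : Prop :=
  ∃ (N' : Type w) (_ : L.Structure N') (g : N ↪ₑ[L] N') (n : ℕ) (b' : Fin n → ℕ)
    (ψ : ∀ j, L.Formula (Fin a ⊕ Fin (b' j))) (e : ∀ j, Fin (b' j) → N'),
    (∀ j, L.Divides (g '' A) (ψ j) (e j)) ∧
    ∀ x : Fin a → N', φ.Realize (Sum.elim x (g ∘ d)) → ∃ j, (ψ j).Realize (Sum.elim x (e j))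

/-- The complete type `tp(c / B)` of an element `c` forks over `A`. -/
def TypeForks {N : Type w} [L.Structure N] (A B : Set N) (c : N) : Prop :=
  ∃ (b : ℕ) (φ : L.Formula (Fin 1 ⊕ Fin b)) (d : Fin b → N),
    (∀ i, d i ∈ B) ∧ φ.Realize (Sum.elim (fun _ => c) d) ∧ L.Forks A φ d

/-- `SU(c / A) ≥ n`, for finite `n`: `SU(p) ≥ n + 1` iff `p` has a forking extension `q`
with `SU(q) ≥ n`. -/
def SURankGE : ℕ → ∀ (M : Type w) [L.Structure M], Set M → M → Prop
  | 0, _, _, _, _ => True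
  | n + 1, M, _, A, c =>
    ∃ (N : Type w) (_ : L.Structure N) (f : M ↪ₑ[L] N) (B : Set N) (c' : N),
      f '' A ⊆ B ∧
      L.SameTypeOver (f '' A) (fun _ : Fin 1 => c') (fun _ : Fin 1 => f c) ∧
      L.TypeForks (f '' A) B c' ∧ SURankGE n N B c'

variable {L}

/-- `T` is a model completion of `T₀`: it extends `T₀`, and for every model `M` of `T₀` the theory
`T ∪ Diag(M)` is complete (in particular it is consistent). -/
def IsModelCompletion (T₀ T : L.Theory) : Prop :=
  (∀ φ ∈ T₀, T ⊨ᵇ φ) ∧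
  ∀ M : Theory.ModelType.{u, v, w} T₀,
    ((L.lhomWithConstants M).onTheory T ∪ L.qfDiagram M).IsComplete

/-- Two theories are (logically) equivalent: they have the same consequences. -/
def TheoryEquiv (T T' : L.Theory) : Prop :=
  ∀ φ : L.Sentence, T ⊨ᵇ φ ↔ T' ⊨ᵇ φ

/-- Every formula is equivalent modulo `T` to a quantifier-free one in the same variables. -/
def EliminatesQuantifiers (T : L.Theory) : Prop :=
  ∀ (n : ℕ) (φ : L.Formula (Fin n)),
    ∃ ψ : L.Formula (Fin n), BoundedFormula.IsQF ψ ∧ T ⊨ᵇ φ.iff ψ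

/-- The formula `φ(x̄, ȳ)` has the tree property in `T`: some model has parameters indexed by the
tree of finite sequences of natural numbers such that the formulas at the immediate successors of
any node are `q`-inconsistent, while along any branch the formulas are (finitely) consistent. -/
def HasTreeProperty (T : L.Theory) {a b : ℕ} (φ : L.Formula (Fin a ⊕ Fin b)) : Prop :=
  ∃ (M : Theory.ModelType.{u, v, w} T) (p : List ℕ → Fin b → M) (q : ℕ),
    (∀ (η : List ℕ) (s : Finset ℕ), s.card = q →
      ¬ ∃ x : Fin a → M, ∀ i ∈ s, φ.Realize (Sum.elim x (p (η ++ [i])))) ∧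
    ∀ (σ : ℕ → ℕ) (n : ℕ),
      ∃ x : Fin a → M, ∀ j < n, φ.Realize (Sum.elim x (p (List.ofFn fun i : Fin (j + 1) => σ i)))

/-- `T` is simple: no formula has the tree property. -/
def IsSimpleTheory (T : L.Theory) : Prop :=
  ∀ (a b : ℕ) (φ : L.Formula (Fin a ⊕ Fin b)), ¬ HasTreeProperty.{u, v, w} T φ

/-- `T` has (finite) SU-rank `n`: this is the maximum of the SU-ranks of the complete `1`-types
over the empty set. -/
def HasSURank (T : L.Theory) (n : ℕ) : Prop :=
  (∃ (M : Theory.ModelType.{u, v, w} T) (c : M), L.SURankGE n M ∅ c) ∧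
  ∀ (M : Theory.ModelType.{u, v, w} T) (c : M), ¬ L.SURankGE (n + 1) M ∅ c

end FirstOrder.Language

/-! ### Templates -/

/-- A sequence of finite hypergraphs of arity `r + 1`; the vertex set of the `n`-th one is
`{0, …, size n - 1}`. -/
structure HypergraphSeq (r : ℕ) where
  size : ℕ → ℕ
  E : ∀ n, Set (Fin (r + 1) → Fin (size n))

namespace HypergraphSeq

variable {r : ℕ} (H : HypergraphSeq r)

/-- The `n`-th hypergraph is full: its edge relation is symmetric and it holds on all tuples with
a repetition. -/
def IsFull (n : ℕ) : Prop :=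
  (∀ (σ : Equiv.Perm (Fin (r + 1))), ∀ e ∈ H.E n, e ∘ σ ∈ H.E n) ∧
  ∀ e : Fin (r + 1) → Fin (H.size n), ¬ Function.Injective e → e ∈ H.E n

/-- The pair `(H, f)` is a template of arity `r + 1`. -/
structure IsTemplateWith (f : ℕ → ℕ) : Prop where
  two_le_arity : 2 ≤ r + 1
  pos : ∀ n, f n ≠ 0
  tendsto : Tendsto f atTop atTop
  full : ∀ n, H.IsFull n
  le_size : ∀ n, f n ≤ H.size n
  extension : ∀ (n : ℕ) (i : Fin (f n) → Fin r → Fin (H.size n)),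
    ∃ s : Fin (H.size n), ∀ l, (Fin.cons s (i l) : Fin (r + 1) → Fin (H.size n)) ∈ H.E n

def IsTemplate : Prop := ∃ f : ℕ → ℕ, H.IsTemplateWith f

/-! ### The languages and the universal theories

`N = ⊤` gives the full language and theory, and `N = m` their restrictions to the predicates
indexed by sequences of length at most `m`. -/

/-- `η` belongs to the tree of finite sequences of vertices. -/
def InTree (η : List ℕ) : Prop := ∀ (n : ℕ) (h : n < η.length), η[n] < H.size n

/-- The sequences in the tree of length at most `N`. -/
def Node (N : ℕ∞) : Type := {η : List ℕ // H.InTree η ∧ (η.length : ℕ∞) ≤ N}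

variable {H} in
/-- The vertex `η(n)` of the `n`-th hypergraph. -/
def Node.vertex {N : ℕ∞} (η : H.Node N) (n : ℕ) (h : n < η.1.length) : Fin (H.size n) :=
  ⟨η.1[n], η.2.1 n h⟩

/-- The empty sequence. -/
def root (N : ℕ∞) : H.Node N := ⟨[], by simp [InTree]⟩

variable {H} in
/-- The sequence `η⌢⟨i⟩`. -/
def Node.child {N : ℕ∞} (η : H.Node N) (h : ((η.1.length + 1 : ℕ) : ℕ∞) ≤ N)
    (i : Fin (H.size η.1.length)) : H.Node N :=
  ⟨η.1 ++ [(i : ℕ)], by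
    refine ⟨fun n hn => ?_, by simpa using h⟩
    rcases Nat.lt_or_ge n η.1.length with hlt | hge
    · rw [List.getElem_append_left hlt]
      exact η.2.1 n hlt
    · have hn' : n = η.1.length := by
        simp only [List.length_append, List.length_singleton] at hn
        omega
      subst hn'
      simp⟩

/-- The relation symbols: one `(r + 1)`-place symbol `R` and unary predicates `Q η`. -/
inductive Rel (N : ℕ∞) : ℕ → Type
  | R : Rel N (r + 1)
  | Q (η : H.Node N) : Rel N 1

/-- The language with symbols `R` and `Q η` for `η` of length at most `N`. -/
def language (N : ℕ∞) : FirstOrder.Language.{0, 0} := ⟨fun _ => Empty, H.Rel N⟩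

/-- The atomic formula `R(x_{s 0}, …, x_{s r})`. -/
def relR (N : ℕ∞) {n : ℕ} (s : Fin (r + 1) → Fin n) : (H.language N).BoundedFormula Empty n :=
  FirstOrder.Language.Relations.boundedFormula (L := H.language N) (Rel.R : H.Rel N (r + 1)) fun i => &(s i)

variable {H} in
/-- The atomic formula `Q_η(x_i)`. -/
def predQ {N : ℕ∞} (η : H.Node N) {n : ℕ} (i : Fin n) : (H.language N).BoundedFormula Empty n :=
  FirstOrder.Language.Relations.boundedFormula (L := H.language N) (Rel.Q η : H.Rel N 1) fun _ => &i

/-- The universal theory `T₀` (for `N = ⊤`) and its restriction to the language of level `m`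
(for `N = m`). -/
def baseTheory (N : ℕ∞) : (H.language N).Theory :=
  -- `R` is symmetric
  {φ | ∃ σ : Equiv.Perm (Fin (r + 1)), φ = (H.relR N id ⟹ H.relR N σ).alls} ∪
  -- `R` holds only on tuples of distinct elements
  {φ | ∃ i j : Fin (r + 1), i ≠ j ∧
    φ = ((FirstOrder.Language.Term.bdEqual (&i) (&j)) ⟹ ∼(H.relR N id)).alls} ∪
  -- `Q_⟨⟩` names everything
  {(predQ (H.root N) (0 : Fin 1)).alls} ∪
  -- `Q_ν` refines `Q_η` if `η` is an initial segment of `ν`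
  {φ | ∃ η ν : H.Node N, η.1 <+: ν.1 ∧ φ = (predQ ν (0 : Fin 1) ⟹ predQ η 0).alls} ∪
  -- the predicates at the children of `η` are disjoint
  {φ | ∃ (η : H.Node N) (h : ((η.1.length + 1 : ℕ) : ℕ∞) ≤ N) (i j : Fin (H.size η.1.length)),
    i ≠ j ∧ φ = (∼(predQ (η.child h i) (0 : Fin 1) ⊓ predQ (η.child h j) 0)).alls} ∪
  -- the predicates at the children of `η` cover `Q_η`
  {φ | ∃ (η : H.Node N) (h : ((η.1.length + 1 : ℕ) : ℕ∞) ≤ N),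
    φ = (predQ η (0 : Fin 1) ⟹
      FirstOrder.Language.BoundedFormula.iSup fun i => predQ (η.child h i) 0).alls} ∪
  -- edges forbidden by the `n`-th hypergraph
  {φ | ∃ (η : Fin (r + 1) → H.Node N) (n : ℕ) (h : ∀ i, n < (η i).1.length),
    (fun i => (η i).vertex n (h i)) ∉ H.E n ∧
    φ = ((FirstOrder.Language.BoundedFormula.iInf fun i => predQ (η i) i) ⟹ ∼(H.relR N id)).alls}

/-- The inclusion of the language of level `m` into the full language. -/
def incl (m : ℕ) : H.language m →ᴸ H.language ⊤ where
  onFunction := fun _ f => f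
  onRelation := fun _ s => match s with
    | .R => .R
    | .Q η => .Q ⟨η.1, η.2.1, le_top⟩

/-- `T` is the limit of the theories `Tm m` in the languages of level `m`: every sentence `φ` of
the full language belongs to the language of level `m` for all large enough `m`, and for all large
enough `m` it follows from `Tm m` if and only if it follows from `T`. -/
def IsLimit (Tm : ∀ m : ℕ, (H.language m).Theory) (T : (H.language ⊤).Theory) : Prop :=
  ∀ φ : (H.language ⊤).Sentence, ∀ᶠ m : ℕ in atTop,
    ∃ ψ : (H.language m).Sentence, (H.incl m).onSentence ψ = φ ∧ (Tm m ⊨ᵇ ψ ↔ T ⊨ᵇ φ)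

end HypergraphSeq

/-!
A model of `T₀` is a hypergraph each of whose vertices carries a branch of the tree, its sequence of
colors. The model completion says that for any finite set of vertices there is a new vertex with
prescribed edges to them and with prescribed colors below a level `l`, provided that this is
consistent below `l` and that from level `l` on the template has enough joins: any edges whatsoever
can then be realized by choosing the remaining colors of the new vertex to be joins. Hence a formula
depends only on the equalities, the edges and the colors below some level `l` between its variables,
by a back and forth up to level `l`. As the models at different levels can be compared in this way,
this gives completeness, quantifier elimination and the limit.

Copies of a model that agree up to level `l` over a common part can be amalgamated freely over it.
Thus a formula with a solution that does not meet the new parameters of the copies has a common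
solution for any finite number of copies. Along a path of a tree a tuple can meet new parameters
only finitely often, so there is no tree property; and a type forks only if it contains an equality
with a parameter, so the rank is `1`.
-/

/-! ### Diagrams and model completions -/

open FirstOrder.Language

section ModelCompletion

variable {L : FirstOrder.Language.{u, v}}

theorem isQF_mapTermRel {L' : FirstOrder.Language} {α β : Type*} {n : ℕ}
    {φ : L.BoundedFormula α n} (h : φ.IsQF)
    (ft : ∀ n, L.Term (α ⊕ (Fin n)) → L'.Term (β ⊕ (Fin n)))
    (fr : ∀ n, L.Relations n → L'.Relations n) :
    (φ.mapTermRel (g := id) ft fr fun _ => id).IsQF := by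
  induction h with
  | falsum => exact .falsum
  | of_isAtomic h =>
    cases h with
    | equal => exact (BoundedFormula.IsAtomic.equal _ _).isQF
    | rel => exact (BoundedFormula.IsAtomic.rel _ _).isQF
  | imp _ _ ih₁ ih₂ => exact ih₁.imp ih₂

theorem isQF_equivSentence {α : Type*} {φ : L.Formula α} (h : BoundedFormula.IsQF φ) :
    BoundedFormula.IsQF (Formula.equivSentence φ) :=
  isQF_mapTermRel (isQF_mapTermRel h _ _) _ _

theorem isQF_equivSentence_symm {α : Type*} {φ : L[[α]].Sentence} (h : BoundedFormula.IsQF φ) :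
    BoundedFormula.IsQF (Formula.equivSentence.symm φ) :=
  isQF_mapTermRel (isQF_mapTermRel h _ _) _ _

theorem isQF_iInf {α : Type*} {n : ℕ} {ι : Type*} [Finite ι] {f : ι → L.BoundedFormula α n}
    (h : ∀ i, (f i).IsQF) : (BoundedFormula.iInf f).IsQF := by
  have isQF_foldr (s : List (L.BoundedFormula α n)) (hs : ∀ φ ∈ s, φ.IsQF) :
      (s.foldr (· ⊓ ·) ⊤).IsQF := by
    induction s with
    | nil => exact .top
    | cons φ s ih =>
      exact (hs φ List.mem_cons_self).inf (ih fun ψ hψ => hs ψ (List.mem_cons_of_mem _ hψ))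
  refine isQF_foldr _ fun φ hφ => ?_
  obtain ⟨i, -, rfl⟩ := List.mem_map.1 hφ
  exact h i

theorem isQF_iSup {α : Type*} {n : ℕ} {ι : Type*} [Finite ι] {f : ι → L.BoundedFormula α n}
    (h : ∀ i, (f i).IsQF) : (BoundedFormula.iSup f).IsQF := by
  have isQF_foldr (s : List (L.BoundedFormula α n)) (hs : ∀ φ ∈ s, φ.IsQF) :
      (s.foldr (· ⊔ ·) ⊥).IsQF := by
    induction s with
    | nil => exact BoundedFormula.isQF_bot
    | cons φ s ih =>
      exact (hs φ List.mem_cons_self).sup (ih fun ψ hψ => hs ψ (List.mem_cons_of_mem _ hψ))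
  refine isQF_foldr _ fun φ hφ => ?_
  obtain ⟨i, -, rfl⟩ := List.mem_map.1 hφ
  exact h i

section Diagram

variable {M K : Type*} [L.Structure M] [L.Structure K]

theorem realize_con_of_models_qfDiagram [L[[M]].Structure K]
    [(L.lhomWithConstants M).IsExpansionOn K] (hK : K ⊨ L.qfDiagram M) {φ : L.Formula M}
    (hφ : BoundedFormula.IsQF φ) (h : φ.Realize (id : M → M)) :
    φ.Realize fun a => (L.con a : K) := by
  rw [← Formula.realize_equivSentence]
  exact hK.realize_of_mem _ ⟨isQF_equivSentence hφ, (Formula.realize_equivSentence M φ).2 h⟩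

theorem nonempty_embedding_of_models_qfDiagram [L[[M]].Structure K]
    [(L.lhomWithConstants M).IsExpansionOn K] (hK : K ⊨ L.qfDiagram M) : Nonempty (M ↪[L] K) := by
  have hpos {φ : L.Formula M} (hφ : φ.IsAtomic) := realize_con_of_models_qfDiagram hK hφ.isQF
  have hneg {φ : L.Formula M} (hφ : φ.IsAtomic) := realize_con_of_models_qfDiagram hK hφ.isQF.not
  exact ⟨{
    toFun a := (L.con a : K)
    inj' a b hab := by_contra fun hne =>
      hneg (φ := Term.equal (Term.var a) (Term.var b)) (.equal _ _) hne hab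
    map_fun' f x :=
      (hpos (φ := Term.equal (Term.func f fun i => Term.var (x i))
        (Term.var (Structure.funMap f x))) (.equal _ _) rfl).symm
    map_rel' s x :=
      ⟨fun h => by_contra fun hne =>
        hneg (φ := Relations.formula s fun i => Term.var (x i)) (.rel _ _) hne h,
      hpos (φ := Relations.formula s fun i => Term.var (x i)) (.rel _ _)⟩ }⟩

theorem models_qfDiagram_of_embedding (f : M ↪[L] K) :
    letI := constantsOn.structure (f : M → K)
    K ⊨ L.qfDiagram M := by
  let _ := constantsOn.structure (f : M → K)
  rw [Theory.model_iff]
  rintro φ ⟨hφ, hM⟩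
  rw [← Formula.realize_equivSentence_symm_con] at hM ⊢
  have hK := ((isQF_equivSentence_symm hφ).realize_embedding f
    (v := fun a => (L.con a : M)) (xs := default)).2 hM
  rwa [Subsingleton.elim (f ∘ default) default] at hK

theorem models_onTheory_union_qfDiagram {T : L.Theory} (f : M ↪[L] K) (hK : K ⊨ T) :
    letI := constantsOn.structure (f : M → K)
    K ⊨ (L.lhomWithConstants M).onTheory T ∪ L.qfDiagram M := by
  let _ := constantsOn.structure (f : M → K)
  exact Theory.model_union_iff.2
    ⟨(LHom.onTheory_model _ T).2 hK, models_qfDiagram_of_embedding f⟩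

end Diagram

variable {T₀ T : L.Theory}

theorem models_base_of_isModelCompletion (hT : IsModelCompletion.{u, v, w} T₀ T) {K : Type*}
    [L.Structure K] [Nonempty K] [K ⊨ T] : K ⊨ T₀ :=
  (Theory.model_iff _).2 fun φ hφ => (hT.1 φ hφ).realize_sentence K

theorem isComplete_union_qfDiagram (hT : IsModelCompletion.{u, v, w} T₀ T) {M : Type w}
    [L.Structure M] [Nonempty M] [M ⊨ T₀] :
    ((L.lhomWithConstants M).onTheory T ∪ L.qfDiagram M).IsComplete :=
  hT.2 (Theory.ModelType.of T₀ M)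

theorem exists_embedding_of_isModelCompletion (hT : IsModelCompletion.{u, v, max u v w} T₀ T)
    {M : Type max u v w} [L.Structure M] [Nonempty M] (hM : M ⊨ T₀) :
    ∃ (K : Type max u v w) (_ : L.Structure K) (_ : Nonempty K), K ⊨ T ∧ Nonempty (M ↪[L] K) := by
  obtain ⟨K⟩ := (isComplete_union_qfDiagram hT (M := M)).1
  have hK := Theory.model_union_iff.1 K.is_model
  let _ : L.Structure K := (L.lhomWithConstants M).reduct K
  exact ⟨K, inferInstance, inferInstance, (LHom.onTheory_model _ T).1 hK.1,
    nonempty_embedding_of_models_qfDiagram hK.2⟩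

theorem realize_embedding_iff_models (hT : IsModelCompletion.{u, v, w} T₀ T) {M : Type w}
    {K : Type*} [L.Structure M] [L.Structure K] [Nonempty M] (hM : M ⊨ T₀) (hK : K ⊨ T)
    (f : M ↪[L] K) {α : Type*} (φ : L.Formula α) (x : α → M) :
    φ.Realize (f ∘ x) ↔ ((L.lhomWithConstants M).onTheory T ∪ L.qfDiagram M) ⊨ᵇ
      Formula.equivSentence (φ.relabel x) := by
  have : Nonempty K := ⟨f (Classical.arbitrary M)⟩
  let _ := constantsOn.structure (f : M → K)
  have := models_onTheory_union_qfDiagram f hK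
  rw [← (isComplete_union_qfDiagram hT (M := M)).realize_sentence_iff _ K,
    Formula.realize_equivSentence, Formula.realize_relabel]
  rfl

theorem realize_comp_embedding_iff (hT : IsModelCompletion.{u, v, w} T₀ T) {K : Type w}
    {K' : Type*} [L.Structure K] [L.Structure K'] [Nonempty K] (hK : K ⊨ T) (hK' : K' ⊨ T)
    (f : K ↪[L] K') {α : Type*} (φ : L.Formula α) (x : α → K) :
    φ.Realize (f ∘ x) ↔ φ.Realize x := by
  have hK₀ : K ⊨ T₀ := models_base_of_isModelCompletion hT
  rw [realize_embedding_iff_models hT hK₀ hK' f,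
    ← realize_embedding_iff_models hT hK₀ hK (Embedding.refl L K)]
  rfl

/- `G` embeds into a model of `T`, over which `K` is elementary: so `K` is existentially closed in
`G`. -/
theorem models_of_isModelCompletion_of_embedding (hT : IsModelCompletion.{u, v, max u v w} T₀ T)
    {K G : Type max u v w} [L.Structure K] [L.Structure G] [Nonempty K] (hK : K ⊨ T) (hG : G ⊨ T₀)
    (f : K ↪[L] G) {n : ℕ} {θ : L.BoundedFormula Empty n} {χ : L.BoundedFormula Empty (n + 1)}
    (hθ : θ.IsQF) (hχ : χ.IsQF) (h : G ⊨ (θ ⟹ ∃' χ).alls) : K ⊨ (θ ⟹ ∃' χ).alls := by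
  have : Nonempty G := ⟨f (Classical.arbitrary K)⟩
  obtain ⟨K', _, _, hK', ⟨g⟩⟩ := exists_embedding_of_isModelCompletion hT hG
  refine BoundedFormula.realize_alls.2 fun x hx => ?_
  have hGx := BoundedFormula.realize_alls.1 h (f ∘ x)
  rw [BoundedFormula.realize_imp, BoundedFormula.realize_ex] at hGx
  obtain ⟨y, hy⟩ := hGx (by
    rwa [← hθ.realize_embedding f, Subsingleton.elim (f ∘ default) default] at hx)
  have hK'x : (∃' χ).Realize (g.comp f ∘ default) (g.comp f ∘ x) := by
    rw [← hχ.realize_embedding g, Fin.comp_snoc,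
      Subsingleton.elim (g ∘ default) (g.comp f ∘ default)] at hy
    exact BoundedFormula.realize_ex.2 ⟨g y, hy⟩
  exact (BoundedFormula.realize_toFormula _ (Sum.elim default x)).1
    ((realize_comp_embedding_iff hT hK hK' (g.comp f) (∃' χ).toFormula (Sum.elim default x)).1
      ((BoundedFormula.realize_toFormula _ _).2 hK'x))

theorem models_sentence_of_forall {φ : L.Sentence}
    (h : ∀ (K : Type max u v w) [L.Structure K] [Nonempty K], K ⊨ T → K ⊨ φ) : T ⊨ᵇ φ := by
  rw [Theory.models_sentence_iff]
  intro M
  let _ : L.Structure (ULift.{w} M) := Equiv.ulift.{w}.symm.inducedStructure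
  let e : M ≃[L] ULift.{w} M := Equiv.ulift.{w}.symm.inducedStructureEquiv
  have : ULift.{w} M ⊨ T := StrongHomClass.theory_model e
  exact (StrongHomClass.realize_sentence e φ).2
    (h _ this)

end ModelCompletion

section FiniteCase

variable {L : FirstOrder.Language.{u, v}} {α : Type w} {ι : Type*} [Finite ι]

open Classical in
/-- The formula saying which members of the finite family `Δ` hold: precisely those in `S`. -/
noncomputable def stateFormula (Δ : ι → L.Formula α) (S : Set ι) : L.Formula α :=
  BoundedFormula.iInf fun i => if i ∈ S then Δ i else (Δ i).not

theorem isQF_stateFormula {Δ : ι → L.Formula α} (hΔ : ∀ i, BoundedFormula.IsQF (Δ i))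
    (S : Set ι) : BoundedFormula.IsQF (stateFormula Δ S) := by
  refine isQF_iInf fun i => ?_
  split_ifs
  exacts [hΔ i, (hΔ i).not]

theorem realize_stateFormula {Δ : ι → L.Formula α} {S : Set ι} {M : Type*} [L.Structure M]
    {c : α → M} : (stateFormula Δ S).Realize c ↔ S = {i | (Δ i).Realize c} := by
  rw [stateFormula, Formula.Realize, BoundedFormula.realize_iInf, Set.ext_iff]
  refine forall_congr' fun i => ?_
  split_ifs with hi
  · exact (iff_true_left hi).symm
  · exact Formula.realize_not.trans (iff_false_left hi).symm

theorem exists_isQF_iff_of_finite {T : L.Theory} {Δ : ι → L.Formula α}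
    (hΔ : ∀ i, BoundedFormula.IsQF (Δ i)) {φ : L.Formula α}
    (h : ∀ (M₁ M₂ : Theory.ModelType.{u, v, max u v w} T) (c : α → M₁) (d : α → M₂),
      (∀ i, (Δ i).Realize c ↔ (Δ i).Realize d) → φ.Realize c → φ.Realize d) :
    ∃ ψ : L.Formula α, BoundedFormula.IsQF ψ ∧ T ⊨ᵇ φ.iff ψ := by
  let good : Set (Set ι) := {S | ∃ (M : Theory.ModelType.{u, v, max u v w} T) (c : α → M),
    S = {i | (Δ i).Realize c} ∧ φ.Realize c}
  refine ⟨BoundedFormula.iSup fun S : good => stateFormula Δ S.1,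
    isQF_iSup fun S => isQF_stateFormula hΔ S.1, fun M c xs => ?_⟩
  rw [Subsingleton.elim xs default]
  refine BoundedFormula.realize_iff.2 ⟨fun hc => BoundedFormula.realize_iSup.2
    ⟨⟨_, M, c, rfl, hc⟩, realize_stateFormula.2 rfl⟩, fun hc => ?_⟩
  obtain ⟨⟨_, M', d, rfl, hd⟩, hS⟩ := BoundedFormula.realize_iSup.1 hc
  exact h M' M d c (fun i => Set.ext_iff.1 (realize_stateFormula.1 hS) i) hd

end FiniteCase

section Forking

variable {L : FirstOrder.Language.{u, v}} {M : Type w} [L.Structure M]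

theorem not_divides_of_forall_mem {a b : ℕ} {A : Set M} {φ : L.Formula (Fin a ⊕ Fin b)}
    {d : Fin b → M} {x : Fin a → M} (hx : ∀ k, x k ∈ A) (hφ : φ.Realize (Sum.elim x d)) :
    ¬ L.Divides A φ d := by
  rintro ⟨M', _, g, q, c, hc, hinc⟩
  refine hinc (Finset.range q) (Finset.card_range q) ⟨g ∘ x, fun i _ => ?_⟩
  let θ : L.Formula (g '' A ⊕ Fin b) :=
    φ.relabel (Sum.elim (fun k => Sum.inl ⟨g (x k), Set.mem_image_of_mem g (hx k)⟩) Sum.inr)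
  have realize_θ (e : Fin b → M') :
      θ.Realize (Sum.elim (fun a : g '' A => (a : M')) e) ↔ φ.Realize (Sum.elim (g ∘ x) e) := by
    rw [Formula.realize_relabel, Sum.comp_elim]
    rfl
  rw [← realize_θ, hc i θ, realize_θ, ← Sum.comp_elim, g.map_formula]
  exact hφ

theorem not_typeForks_of_mem {A B : Set M} {c : M} (hc : c ∈ A) : ¬ L.TypeForks A B c := by
  rintro ⟨b, φ, d, -, hφ, M', _, g, n, b', ψ, e, hdiv, hcov⟩
  have hgφ := (g.map_formula φ _).2 hφ
  rw [Sum.comp_elim] at hgφ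
  obtain ⟨j, hj⟩ := hcov _ hgφ
  exact not_divides_of_forall_mem (fun _ => Set.mem_image_of_mem g hc) hj (hdiv j)

theorem eq_of_sameTypeOver_of_mem {A : Set M} {c c' : M} (hc : c ∈ A)
    (h : L.SameTypeOver A (fun _ : Fin 1 => c') fun _ : Fin 1 => c) : c' = c :=
  (h (Term.equal (Term.var (Sum.inr 0)) (Term.var (Sum.inl ⟨c, hc⟩)))).2 rfl

/-- After one forking extension the element is a parameter, so that its type no longer forks. -/
theorem not_suRankGE_two_of_forall_typeForks {T : L.Theory} (hM : M ⊨ T)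
    (hT : ∀ (M' : Type w) [L.Structure M'], M' ⊨ T → ∀ (A B : Set M') (c : M'),
      L.TypeForks A B c → c ∈ B) (A : Set M) (c : M) : ¬ L.SURankGE 2 M A c := by
  rintro ⟨M₁, _, f₁, B₁, c₁, -, -, hfork₁, M₂, _, f₂, B₂, c₂, -, hsame, hfork₂, -⟩
  have hc₁ : f₂ c₁ ∈ f₂ '' B₁ :=
    Set.mem_image_of_mem f₂ (hT M₁ ((f₁.theory_model_iff T).1 hM) _ B₁ c₁ hfork₁)
  exact not_typeForks_of_mem (eq_of_sameTypeOver_of_mem hc₁ hsame ▸ hc₁) hfork₂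

/-- The formula `x = y`. -/
def eqFormula (L : FirstOrder.Language.{u, v}) : L.Formula (Fin 1 ⊕ Fin 1) :=
  Term.equal (Term.var (Sum.inl 0)) (Term.var (Sum.inr 0))

theorem refl_image (A : Set M) : ElementaryEmbedding.refl L M '' A = A :=
  Set.image_id A

theorem divides_eqFormula {A : Set M} {c : ℕ → M} (hc : Function.Injective c) {m : M}
    (hA : ∀ i, L.SameTypeOver A (fun _ : Fin 1 => c i) fun _ => m) :
    L.Divides A (eqFormula L) fun _ => m := by
  refine ⟨M, _, ElementaryEmbedding.refl L M, 2, fun i _ => c i, fun i => ?_, ?_⟩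
  · rw [refl_image]
    exact hA i
  · rintro s hs ⟨x, hx⟩
    obtain ⟨i, j, hij, rfl⟩ := Finset.card_eq_two.1 hs
    have hi : x 0 = c i := hx i (by simp)
    have hj : x 0 = c j := hx j (by simp)
    exact hij (hc (hi.symm.trans hj))

theorem suRankGE_one_of_divides_eqFormula {A : Set M} {m : M}
    (h : L.Divides A (eqFormula L) fun _ => m) : L.SURankGE 1 M A m := by
  refine ⟨M, _, ElementaryEmbedding.refl L M, insert m A, m, ?_, fun _ => Iff.rfl, ?_, trivial⟩
  · exact (refl_image A).trans_subset (Set.subset_insert m A)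
  · rw [refl_image]
    refine ⟨1, eqFormula L, fun _ => m, fun _ => Set.mem_insert m A, rfl, M, _,
      ElementaryEmbedding.refl L M, 1, fun _ => 1, fun _ => eqFormula L, fun _ _ => m, fun _ => ?_,
      fun x hx => ⟨0, hx⟩⟩
    rwa [refl_image]

end Forking

/-! ### Δ-systems and paths in trees -/

section DeltaSystem

variable {ι V M : Type*} [Finite V] {I : Set ι}

theorem exists_infinite_forall_eq_or_finite_fiber (hI : I.Infinite) (d : ι → V → M) :
    ∃ J ⊆ I, J.Infinite ∧ ∀ p, (∀ i ∈ J, ∀ i' ∈ J, d i p = d i' p) ∨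
      ∀ m, {i ∈ J | d i p = m}.Finite := by
  let IsConst (J : Set ι) (p : V) : Prop := ∀ i ∈ J, ∀ i' ∈ J, d i p = d i' p
  obtain ⟨P, ⟨J, hJI, hJ, hPJ⟩, hmax⟩ :=
    (Set.toFinite {P : Set V | ∃ J ⊆ I, J.Infinite ∧ ∀ p ∈ P, IsConst J p}).exists_maximal
      ⟨∅, I, subset_rfl, hI, fun p hp => hp.elim⟩
  refine ⟨J, hJI, hJ, fun p => or_iff_not_imp_left.2 fun hp m => ?_⟩
  by_contra hinf
  refine hp (hPJ p (hmax (y := insert p P) ⟨{i ∈ J | d i p = m}, fun i hi => hJI hi.1, hinf, ?_⟩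
    (Set.subset_insert p P) (Set.mem_insert p P)))
  rintro p' (rfl | hp') i hi i' hi'
  · exact hi.2.trans hi'.2.symm
  · exact hPJ p' hp' i hi.1 i' hi'.1

theorem exists_infinite_deltaSystem (hI : I.Infinite) (d : ι → V → M) :
    ∃ J ⊆ I, J.Infinite ∧ ∀ i ∈ J, ∀ i' ∈ J, i ≠ i' → ∀ p p',
      d i p = d i' p' → d i' p = d i' p' ∨ d i p = d i p' := by
  obtain ⟨J, hJI, hJ, hconst⟩ := exists_infinite_forall_eq_or_finite_fiber hI d
  let FiniteToOne (p : V) : Prop := ∀ m, {i ∈ J | d i p = m}.Finite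
  obtain ⟨f, hfJ, hf⟩ := exists_seq_of_forall_finset_exists (· ∈ J)
    (fun i i' => i ≠ i' ∧ ∀ p p', FiniteToOne p' → d i p ≠ d i' p') (by
      intro s _
      have hbad : (⋃ i ∈ s, ⋃ p, ⋃ p' ∈ {p' | FiniteToOne p'},
          {i' ∈ J | d i' p' = d i p}).Finite :=
        s.finite_toSet.biUnion fun i _ => Set.finite_iUnion fun p =>
          (Set.toFinite _).biUnion fun p' hp' => hp' _
      obtain ⟨y, hyJ, hy⟩ := (hJ.sdiff (hbad.union s.finite_toSet)).nonempty
      rw [Set.mem_union, not_or] at hy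
      refine ⟨y, hyJ, fun i hi => ⟨fun hiy => hy.2 (hiy ▸ hi), fun p p' hp' h => hy.1 ?_⟩⟩
      simp only [Set.mem_iUnion]
      exact ⟨i, hi, p, p', hp', hyJ, h.symm⟩)
  refine ⟨Set.range f, Set.range_subset_iff.2 fun n => hJI (hfJ n),
    Set.infinite_range_of_injective (.of_lt_imp_ne fun m n hmn => (hf m n hmn).1), ?_⟩
  rintro _ ⟨m, rfl⟩ _ ⟨n, rfl⟩ hne p p' h
  rcases lt_trichotomy m n with hmn | rfl | hmn
  · have hp' := (hconst p').resolve_right fun hp' => (hf m n hmn).2 p p' hp' h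
    exact Or.inr (h.trans (hp' _ (hfJ n) _ (hfJ m)))
  · exact absurd rfl hne
  · have hp := (hconst p).resolve_right fun hp => (hf n m hmn).2 p' p hp h.symm
    exact Or.inl ((hp _ (hfJ n) _ (hfJ m)).trans h)

end DeltaSystem

section Path

/-- The node of length `n` on the path on which each node `η` is followed by `η ++ [next η]`. -/
def treePath (next : List ℕ → ℕ) : ℕ → List ℕ
  | 0 => []
  | n + 1 => treePath next n ++ [next (treePath next n)]

variable {next : List ℕ → ℕ}

theorem ofFn_next_treePath (n : ℕ) :
    (List.ofFn fun i : Fin n => next (treePath next i)) = treePath next n := by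
  induction n with
  | zero => rfl
  | succ n ih =>
    rw [List.ofFn_succ', List.concat_eq_append]
    exact congrArg (· ++ [next (treePath next n)]) ih

theorem treePath_prefix {m n : ℕ} (hmn : m ≤ n) : treePath next m <+: treePath next n := by
  induction hmn with
  | refl => exact List.prefix_rfl
  | step _ ih => exact ih.trans (List.prefix_append _ _)

/-- The parameters attached to the initial segments of `η`. -/
def prefixParams {M : Type*} {b : ℕ} (p : List ℕ → Fin b → M) (η : List ℕ) : Set M :=
  {m | ∃ ν, ν <+: η ∧ m ∈ Set.range (p ν)}

theorem finite_prefixParams {M : Type*} {b : ℕ} (p : List ℕ → Fin b → M) (η : List ℕ) :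
    (prefixParams p η).Finite := by
  have hη : prefixParams p η = ⋃ ν ∈ {ν | ν ∈ η.inits}, Set.range (p ν) := by
    ext m
    simp [prefixParams]
  rw [hη]
  exact (List.finite_toSet η.inits).biUnion fun ν _ => Set.finite_range _

/-- Each entry of `x` can become a new parameter only once along the path. -/
theorem exists_forall_mem_prefixParams {M : Type*} {a b : ℕ} (p : List ℕ → Fin b → M)
    (x : Fin a → M) : ∃ j < a + 1, ∀ k s, x k = p (treePath next (j + 1)) s →
      x k ∈ prefixParams p (treePath next j) := by
  by_contra! hne
  choose k s hk hnew using fun j : Fin (a + 1) => hne j j.2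
  have hinj : Function.Injective k := .of_lt_imp_ne fun j j' hjj h =>
    hnew j' ⟨treePath next (j + 1), treePath_prefix hjj, by rw [← h, hk j]; exact ⟨_, rfl⟩⟩
  simpa using Fintype.card_le_of_injective k hinj

end Path

namespace HypergraphSeq

variable {r : ℕ} {H : HypergraphSeq r}

/-! ### Ample sequences of hypergraphs -/

variable (H) in
/-- From level `l` on and below level `N`, any family of at most `n` vertices admits a vertex
joined to all `r`-tuples from the family. -/
def HasJoins (N : ℕ∞) (l n : ℕ) : Prop :=
  ∀ k ≤ n, ∀ j, l ≤ j → (j : ℕ∞) < N → ∀ c : Fin k → Fin (H.size j),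
    ∃ s : Fin (H.size j), ∀ u : Fin r → Fin k,
      (Fin.cons s (c ∘ u) : Fin (r + 1) → Fin (H.size j)) ∈ H.E j

theorem HasJoins.mono {N N' : ℕ∞} {l l' n n' : ℕ} (h : H.HasJoins N l n) (hN : N' ≤ N)
    (hl : l ≤ l') (hn : n' ≤ n) : H.HasJoins N' l' n' :=
  fun k hk j hj hjN => h k (hk.trans hn) j (hl.trans hj) (hjN.trans_le hN)

variable (H) in
/-- The hypergraphs are nonempty and symmetric, and families of any bounded size eventually have
joins: the combinatorial core of the notion of a template, without a growth function. -/
structure IsAmple : Prop where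
  size_pos : ∀ n, 0 < H.size n
  symm : ∀ (n : ℕ) (σ : Equiv.Perm (Fin (r + 1))), ∀ e ∈ H.E n, e ∘ σ ∈ H.E n
  exists_hasJoins : ∀ n, ∃ l, H.HasJoins ⊤ l n

theorem IsTemplateWith.hasJoins {f : ℕ → ℕ} (hf : H.IsTemplateWith f) {l n : ℕ}
    (hl : ∀ j, l ≤ j → n ^ r ≤ f j) : H.HasJoins ⊤ l n := by
  intro k hk j hj _ c
  have hcard : Fintype.card (Fin r → Fin k) ≤ Fintype.card (Fin (f j)) := by
    simpa using (Nat.pow_le_pow_left hk r).trans (hl j hj)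
  obtain ⟨ι⟩ := Function.Embedding.nonempty_of_card_le hcard
  rcases isEmpty_or_nonempty (Fin r → Fin k) with _ | _
  · exact ⟨⟨0, (Nat.pos_of_ne_zero (hf.pos j)).trans_le (hf.le_size j)⟩, isEmptyElim⟩
  · obtain ⟨s, hs⟩ := hf.extension j fun i => c ∘ Function.invFun ι i
    exact ⟨s, fun u => by simpa only [Function.leftInverse_invFun ι.injective u] using hs (ι u)⟩

theorem IsTemplate.isAmple (hH : H.IsTemplate) : H.IsAmple where
  size_pos n := by
    obtain ⟨f, hf⟩ := hH
    exact (Nat.pos_of_ne_zero (hf.pos n)).trans_le (hf.le_size n)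
  symm n := by
    obtain ⟨f, hf⟩ := hH
    exact (hf.full n).1
  exists_hasJoins n := by
    obtain ⟨f, hf⟩ := hH
    obtain ⟨l, hl⟩ := (hf.tendsto.eventually_ge_atTop (n ^ r)).exists_forall_of_atTop
    exact ⟨l, hf.hasJoins hl⟩

/-! ### Colored hypergraphs -/

variable (H) in
/-- A hypergraph on `M` together with a branch of the tree for each vertex. -/
structure ColoredHypergraph (M : Type*) where
  color : M → ∀ j, Fin (H.size j)
  edge : (Fin (r + 1) → M) → Prop

namespace ColoredHypergraph

variable {M M' M'' V W : Type*}

/-- The properties of the colored hypergraphs that come from models of `T₀` of level `N`. The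
colors at the levels from `N` on are irrelevant and normalized to be `0`. -/
structure IsBase (N : ℕ∞) (C : H.ColoredHypergraph M) : Prop where
  symm : ∀ (σ : Equiv.Perm (Fin (r + 1))) x, C.edge x → C.edge (x ∘ σ)
  inj : ∀ x, C.edge x → Function.Injective x
  compat : ∀ x, C.edge x → ∀ j : ℕ, (j : ℕ∞) < N → (fun i => C.color (x i) j) ∈ H.E j
  zero : ∀ x (j : ℕ), N ≤ j → (C.color x j : ℕ) = 0

/-- The extension property of the colored hypergraphs that come from models of the model
completion of level `N`: there is a vertex with prescribed colors `β` below level `l`, joined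
precisely to the `r`-tuples of a prescribed set `P` from a finite family `x`, as soon as the colors
below level `l` permit this and joins exist from level `l` on. -/
structure IsGeneric (N : ℕ∞) (C : H.ColoredHypergraph M) : Prop extends C.IsBase N where
  extension : ∀ {n : ℕ} (x : Fin n → M) (P : Set (Fin r → Fin n)) (l : ℕ)
    (β : ∀ j, Fin (H.size j)), Function.Injective x → (l : ℕ∞) ≤ N → H.HasJoins N l n →
    (∀ u ∈ P, ∀ σ : Equiv.Perm (Fin r), u ∘ σ ∈ P) → (∀ u ∈ P, Function.Injective u) →
    (∀ u ∈ P, ∀ j < l,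
      (Fin.cons (β j) fun i => C.color (x (u i)) j : Fin (r + 1) → Fin (H.size j)) ∈ H.E j) →
    ∃ y ∉ Set.range x, (∀ j < l, C.color y j = β j) ∧
      ∀ u : Fin r → Fin n, C.edge (Fin.cons y (x ∘ u)) ↔ u ∈ P

/-- The tuples `c` and `d` are isomorphic as far as equality, the edges, and the colors at the
levels below `l` are concerned. -/
structure Agree (l : ℕ) (C : H.ColoredHypergraph M) (C' : H.ColoredHypergraph M')
    (c : V → M) (d : V → M') : Prop where
  eq_iff : ∀ i j, c i = c j ↔ d i = d j
  color_eq : ∀ i, ∀ j < l, C.color (c i) j = C'.color (d i) j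
  edge_iff : ∀ u : Fin (r + 1) → V, C.edge (c ∘ u) ↔ C'.edge (d ∘ u)

variable {C : H.ColoredHypergraph M} {C' : H.ColoredHypergraph M'} {C'' : H.ColoredHypergraph M''}
  {N N' : ℕ∞} {l : ℕ} {c : V → M} {d : V → M'} {e : V → M''}

namespace Agree

theorem mono {l' : ℕ} (h : Agree l C C' c d) (hl : l' ≤ l) : Agree l' C C' c d :=
  ⟨h.eq_iff, fun i j hj => h.color_eq i j (hj.trans_le hl), h.edge_iff⟩

theorem symm (h : Agree l C C' c d) : Agree l C' C d c :=
  ⟨fun i j => (h.eq_iff i j).symm, fun i j hj => (h.color_eq i j hj).symm,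
    fun u => (h.edge_iff u).symm⟩

theorem trans (h : Agree l C C' c d) (h' : Agree l C' C'' d e) : Agree l C C'' c e :=
  ⟨fun i j => (h.eq_iff i j).trans (h'.eq_iff i j),
    fun i j hj => (h.color_eq i j hj).trans (h'.color_eq i j hj),
    fun u => (h.edge_iff u).trans (h'.edge_iff u)⟩

theorem comp (h : Agree l C C' c d) (w : W → V) : Agree l C C' (c ∘ w) (d ∘ w) :=
  ⟨fun i j => h.eq_iff (w i) (w j), fun i => h.color_eq (w i), fun u => h.edge_iff (w ∘ u)⟩

end Agree

theorem lt_iff_of_min_eq {N N' : ℕ∞} {j l : ℕ} (hN : min N l = min N' l) (hj : j < l) :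
    (j : ℕ∞) < N ↔ (j : ℕ∞) < N' := by
  have hj' : (j : ℕ∞) < l := by exact_mod_cast hj
  rw [← and_iff_left (a := (j : ℕ∞) < N) hj', ← lt_min_iff, hN, lt_min_iff, and_iff_left hj']

namespace IsBase

theorem edge_comp_iff (hC : C.IsBase N) (σ : Equiv.Perm (Fin (r + 1))) (x : Fin (r + 1) → M) :
    C.edge (x ∘ σ) ↔ C.edge x := by
  refine ⟨fun h => ?_, hC.symm σ x⟩
  simpa [Function.comp_assoc] using hC.symm σ.symm _ h

theorem edge_cons_comp_iff (hC : C.IsBase N) (σ : Equiv.Perm (Fin r)) (a : M) (x : Fin r → M) :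
    C.edge (Fin.cons a (x ∘ σ)) ↔ C.edge (Fin.cons a x) := by
  rw [← hC.edge_comp_iff (Equiv.Perm.decomposeFin.symm (0, σ)) (Fin.cons a x)]
  refine iff_of_eq (congrArg C.edge (funext fun i => ?_))
  refine Fin.cases ?_ (fun i => ?_) i <;> simp

theorem color_eq_of_min_eq (hC : C.IsBase N) (hC' : C'.IsBase N') (hN : min N l = min N' l)
    {x : M} {y : M'} (h : ∀ j < l, (j : ℕ∞) < N → C.color x j = C'.color y j) :
    ∀ j < l, C.color x j = C'.color y j := by
  intro j hj
  by_cases hjN : (j : ℕ∞) < N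
  · exact h j hj hjN
  · have hjN' : ¬ (j : ℕ∞) < N' := mt (lt_iff_of_min_eq hN hj).2 hjN
    exact Fin.ext ((hC.zero x j (not_lt.1 hjN)).trans (hC'.zero y j (not_lt.1 hjN')).symm)

end IsBase

theorem exists_eq_cons_none {u : Fin (r + 1) → Option V} (hu : Function.Injective u)
    (h0 : u 0 = none) : ∃ w : Fin r → V, u = Fin.cons none (some ∘ w) := by
  have hne (i : Fin r) : u i.succ ≠ none := fun hi =>
    Fin.succ_ne_zero i (hu (hi.trans h0.symm))
  choose w hw using fun i => Option.ne_none_iff_exists'.1 (hne i)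
  exact ⟨w, funext fun i => Fin.cases h0 hw i⟩

theorem Agree.option (h : Agree l C C' c d) (hC : C.IsBase N) (hC' : C'.IsBase N')
    {x : M} {y : M'} (hx : ∀ i, c i ≠ x) (hy : ∀ i, d i ≠ y)
    (hcolor : ∀ j < l, C.color x j = C'.color y j)
    (hedge : ∀ w : Fin r → V, C.edge (Fin.cons x (c ∘ w)) ↔ C'.edge (Fin.cons y (d ∘ w))) :
    Agree l C C' (fun o : Option V => o.elim x c) (fun o => o.elim y d) where
  eq_iff := by
    rintro (_ | i) (_ | j)
    · simp
    · simp [(hx j).symm, (hy j).symm]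
    · simp [hx i, hy i]
    · exact h.eq_iff i j
  color_eq := by
    rintro (_ | i)
    · exact hcolor
    · exact h.color_eq i
  edge_iff u := by
    by_cases hu : Function.Injective u
    swap
    · exact iff_of_false (fun he => hu (Function.Injective.of_comp (hC.inj _ he)))
        fun he => hu (Function.Injective.of_comp (hC'.inj _ he))
    by_cases hnone : ∃ i, u i = none
    · obtain ⟨i, hi⟩ := hnone
      obtain ⟨w, hw⟩ := exists_eq_cons_none (u := u ∘ Equiv.swap 0 i)
        (hu.comp (Equiv.injective _)) (by simp [hi])
      rw [← hC.edge_comp_iff (Equiv.swap 0 i), ← hC'.edge_comp_iff (Equiv.swap 0 i),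
        Function.comp_assoc, Function.comp_assoc, hw, Fin.comp_cons, Fin.comp_cons]
      exact hedge w
    · push Not at hnone
      choose w hw using fun i => Option.ne_none_iff_exists'.1 (hnone i)
      obtain rfl : u = some ∘ w := funext hw
      exact h.edge_iff w

/-! ### Back and forth -/

namespace IsGeneric

theorem exists_notMem_finset (hC : C.IsGeneric N) (F : Finset M) (P : Set (Fin r → M))
    (β : ∀ j, Fin (H.size j)) (hl : H.HasJoins ⊤ l F.card)
    (hPsymm : ∀ u ∈ P, ∀ σ : Equiv.Perm (Fin r), u ∘ σ ∈ P)
    (hPinj : ∀ u ∈ P, Function.Injective u)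
    (hPcompat : ∀ u ∈ P, ∀ j < l, (j : ℕ∞) < N →
      (Fin.cons (β j) fun i => C.color (u i) j : Fin (r + 1) → Fin (H.size j)) ∈ H.E j) :
    ∃ y ∉ F, (∀ j < l, (j : ℕ∞) < N → C.color y j = β j) ∧
      ∀ u : Fin r → M, (∀ i, u i ∈ F) → (C.edge (Fin.cons y u) ↔ u ∈ P) := by
  obtain ⟨m, hm⟩ : ∃ m : ℕ, (m : ℕ∞) = min N l :=
    ENat.ne_top_iff_exists.1 (min_lt_of_right_lt (ENat.natCast_lt_top l)).ne
  have lt_m_iff (j : ℕ) : j < m ↔ (j : ℕ∞) < N ∧ j < l := by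
    rw [← ENat.natCast_lt_natCast, hm, lt_min_iff, ENat.natCast_lt_natCast]
  have hjoins : H.HasJoins N m F.card := fun k hk j hj hjN =>
    hl k hk j (not_lt.1 fun hjl => hj.not_gt ((lt_m_iff j).2 ⟨hjN, hjl⟩)) (ENat.natCast_lt_top j)
  obtain ⟨x, hx, hxF⟩ : ∃ x : Fin F.card → M, Function.Injective x ∧ Set.range x = F :=
    ⟨_, Subtype.val_injective.comp F.equivFin.symm.injective, by simp [Set.range_comp]⟩
  obtain ⟨y, hy, hyc, hye⟩ := hC.extension x {u | x ∘ u ∈ P} m β hx (hm ▸ min_le_left _ _) hjoins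
    (fun u hu σ => hPsymm _ hu σ) (fun u hu => .of_comp (hPinj _ hu))
    fun u hu j hj => hPcompat _ hu j ((lt_m_iff j).1 hj).2 ((lt_m_iff j).1 hj).1
  refine ⟨y, fun hyF => hy (hxF ▸ hyF), fun j hjl hjN => hyc j ((lt_m_iff j).2 ⟨hjN, hjl⟩),
    fun u hu => ?_⟩
  choose w hw using fun i => (hxF ▸ hu i : u i ∈ Set.range x)
  obtain rfl : x ∘ w = u := funext hw
  exact hye w

theorem exists_agree_option_notMem (hC : C.IsBase N) (hC' : C'.IsGeneric N')
    (hN : min N l = min N' l) (h : Agree l C C' c d) {F : Finset M'} (hd : ∀ i, d i ∈ F)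
    (hl : H.HasJoins ⊤ l F.card) {x : M} (hx : ∀ i, c i ≠ x) :
    ∃ y ∉ F, Agree l C C' (fun o : Option V => o.elim x c) (fun o => o.elim y d) := by
  let P : Set (Fin r → M') := {u | ∃ w, u = d ∘ w ∧ C.edge (Fin.cons x (c ∘ w))}
  have hPsymm : ∀ u ∈ P, ∀ σ : Equiv.Perm (Fin r), u ∘ σ ∈ P := by
    rintro _ ⟨w, rfl, he⟩ σ
    exact ⟨w ∘ σ, rfl, (hC.edge_cons_comp_iff σ x (c ∘ w)).2 he⟩
  have hPinj : ∀ u ∈ P, Function.Injective u := by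
    rintro _ ⟨w, rfl, he⟩ i i' hii
    exact (Fin.cons_injective_iff.1 (hC.inj _ he)).2 ((h.eq_iff _ _).2 hii)
  have hPcompat : ∀ u ∈ P, ∀ j < l, (j : ℕ∞) < N' →
      (Fin.cons (C.color x j) fun i => C'.color (u i) j :
        Fin (r + 1) → Fin (H.size j)) ∈ H.E j := by
    rintro _ ⟨w, rfl, he⟩ j hjl hjN
    convert hC.compat _ he j ((lt_iff_of_min_eq hN hjl).2 hjN) using 1
    exact funext (Fin.cases rfl fun i => (h.color_eq (w i) j hjl).symm)
  obtain ⟨y, hyF, hyc, hye⟩ :=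
    hC'.exists_notMem_finset F P (C.color x) hl hPsymm hPinj hPcompat
  refine ⟨y, hyF, h.option hC hC'.toIsBase hx (fun i hi => hyF (hi ▸ hd i))
    (hC.color_eq_of_min_eq hC'.toIsBase hN fun j hjl hjN =>
      (hyc j hjl ((lt_iff_of_min_eq hN hjl).1 hjN)).symm) fun w => ?_⟩
  rw [hye (d ∘ w) fun i => hd (w i)]
  refine ⟨fun he => ⟨w, rfl, he⟩, ?_⟩
  rintro ⟨w', hw', he⟩
  rwa [show c ∘ w = c ∘ w' from funext fun i => (h.eq_iff _ _).2 (congrFun hw' i)]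

theorem exists_agree_option [Finite V] (hC : C.IsBase N) (hC' : C'.IsGeneric N')
    (hN : min N l = min N' l) (h : Agree l C C' c d) (hl : H.HasJoins ⊤ l (Nat.card V)) (x : M) :
    ∃ y, Agree l C C' (fun o : Option V => o.elim x c) (fun o => o.elim y d) := by
  classical
  by_cases hx : ∃ i, c i = x
  · obtain ⟨i, rfl⟩ := hx
    refine ⟨d i, ?_⟩
    convert h.comp fun o : Option V => o.elim i id using 2 with o o <;> cases o <;> rfl
  · push Not at hx
    have := Fintype.ofFinite V
    obtain ⟨y, -, hy⟩ := hC'.exists_agree_option_notMem hC hN h (F := Finset.univ.image d)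
      (by simp) (hl.mono le_rfl le_rfl (Finset.card_image_le.trans_eq (by simp))) hx
    exact ⟨y, hy⟩

theorem exists_agree_sum [Finite V] (hC : C.IsBase N) (hC' : C'.IsGeneric N')
    (hN : min N l = min N' l) (h : Agree l C C' c d) {a : ℕ}
    (hl : H.HasJoins ⊤ l (Nat.card V + a)) (x : Fin a → M) :
    ∃ y : Fin a → M', Agree l C C' (Sum.elim c x) (Sum.elim d y) := by
  induction a with
  | zero =>
    refine ⟨Fin.elim0, ?_⟩
    convert h.comp (Sum.elim id Fin.elim0) using 1 <;> ext (_ | i) <;> first | rfl | exact i.elim0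
  | succ a ih =>
    obtain ⟨y, hy⟩ := ih (hl.mono le_rfl le_rfl (by omega)) (Fin.tail x)
    obtain ⟨y₀, hy₀⟩ := hC'.exists_agree_option hC hN hy
      (hl.mono le_rfl le_rfl (by simp [Nat.card_sum])) (x 0)
    refine ⟨Fin.cons y₀ y, ?_⟩
    convert hy₀.comp (Sum.elim (some ∘ Sum.inl) (Fin.cons none (some ∘ Sum.inr))) using 1 <;>
      ext (i | i) <;> first | rfl | exact Fin.cases rfl (fun _ => rfl) i

end IsGeneric

end ColoredHypergraph

/-! ### Generic extensions -/

variable (H) in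
/-- The branches of the tree, normalized to be `0` at the levels from `N` on. -/
def Branch (N : ℕ∞) : Type :=
  {β : ∀ j, Fin (H.size j) // ∀ j : ℕ, N ≤ j → (β j : ℕ) = 0}

variable (H) in
/-- The vertex set of the free generic extension of a colored hypergraph on `M`: for all finite
sequences `x` of vertices there are new vertices of all colors, joined to any prescribed set of
`r`-tuples from `x`. -/
inductive GenericExt (N : ℕ∞) (M : Type w) : Type w
  | base (a : M) : GenericExt N M
  | new (β : H.Branch N) (n : ℕ) (x : Fin n → GenericExt N M) (P : Set (Fin r → Fin n)) :
      GenericExt N M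

namespace GenericExt

open ColoredHypergraph

variable {N : ℕ∞} {M : Type w}

/-- The stage at which a vertex of the free generic extension is created: later than the vertices
to which it is joined on creation. -/
def rank : H.GenericExt N M → ℕ
  | base _ => 0
  | new _ _ x _ => (Finset.univ.sup fun i => (x i).rank) + 1

theorem rank_lt_rank_new (β : H.Branch N) {n : ℕ} (x : Fin n → H.GenericExt N M)
    (P : Set (Fin r → Fin n)) (i : Fin n) : (x i).rank < (new β n x P).rank :=
  Nat.lt_succ_of_le (Finset.le_sup (f := fun i => (x i).rank) (Finset.mem_univ i))

theorem new_notMem_range (β : H.Branch N) {n : ℕ} (x : Fin n → H.GenericExt N M)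
    (P : Set (Fin r → Fin n)) : new β n x P ∉ Set.range x := by
  rintro ⟨i, hi⟩
  exact (rank_lt_rank_new β x P i).ne (congrArg rank hi)

theorem base_injective : Function.Injective (base : M → H.GenericExt N M) :=
  fun _ _ h => by cases h; rfl

/-- The branch attached to a vertex of the free generic extension. -/
def color (C : H.ColoredHypergraph M) : H.GenericExt N M → ∀ j, Fin (H.size j)
  | base a => C.color a
  | new β _ _ _ => β.1

/-- The free generic extension of a colored hypergraph: its edges are the old ones and those
prescribed on the creation of a new vertex, as far as these are compatible with the hypergraphs
below level `N`. -/
def coloredHypergraph (N : ℕ∞) (C : H.ColoredHypergraph M) :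
    H.ColoredHypergraph (H.GenericExt N M) where
  color := color C
  edge z := Function.Injective z ∧
    (∀ j : ℕ, (j : ℕ∞) < N → (fun i => color C (z i) j) ∈ H.E j) ∧
    ((∃ x, z = base ∘ x ∧ C.edge x) ∨
      ∃ (β : H.Branch N) (n : ℕ) (x : Fin n → H.GenericExt N M) (P : Set (Fin r → Fin n)),
        ∃ u ∈ P, ∃ σ : Equiv.Perm (Fin (r + 1)), z ∘ σ = Fin.cons (new β n x P) (x ∘ u))

variable {C : H.ColoredHypergraph M}

theorem edge_base_iff (hC : C.IsBase N) (x : Fin (r + 1) → M) :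
    (coloredHypergraph N C).edge (base ∘ x) ↔ C.edge x := by
  constructor
  · rintro ⟨-, -, ⟨y, hy, he⟩ | ⟨β, n, y, P, u, -, σ, hz⟩⟩
    · rwa [base_injective.comp_left hy]
    · simpa using congrFun hz 0
  · exact fun he => ⟨base_injective.comp (hC.inj x he), hC.compat x he, Or.inl ⟨x, rfl, he⟩⟩

theorem rank_cons_new_lt (β : H.Branch N) {n : ℕ} (x : Fin n → H.GenericExt N M)
    (P : Set (Fin r → Fin n)) (u : Fin r → Fin n) {i : Fin (r + 1)} (hi : i ≠ 0) :
    rank ((Fin.cons (new β n x P) (x ∘ u) : Fin (r + 1) → H.GenericExt N M) i) <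
      (new β n x P).rank := by
  obtain ⟨i, rfl⟩ := Fin.exists_succ_eq.2 hi
  exact rank_lt_rank_new β x P (u i)

-- The vertex created last is determined by its rank, so `σ` cannot move it.
theorem perm_zero_of_cons_new_comp {β β' : H.Branch N} {n n' : ℕ} {x : Fin n → H.GenericExt N M}
    {x' : Fin n' → H.GenericExt N M} {P : Set (Fin r → Fin n)} {P' : Set (Fin r → Fin n')}
    {u : Fin r → Fin n} {u' : Fin r → Fin n'} {σ : Equiv.Perm (Fin (r + 1))}
    (h : (Fin.cons (new β n x P) (x ∘ u) : Fin (r + 1) → H.GenericExt N M) ∘ σ =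
      Fin.cons (new β' n' x' P') (x' ∘ u')) : σ 0 = 0 := by
  by_contra hσ
  have hσ' : σ.symm 0 ≠ 0 := fun h0 => hσ (σ.symm_apply_eq.1 h0).symm
  have hlt := rank_cons_new_lt β x P u hσ
  have hlt' := rank_cons_new_lt β' x' P' u' hσ'
  rw [← h, Function.comp_apply, Equiv.apply_symm_apply, Fin.cons_zero] at hlt'
  have h0 := congrFun h 0
  rw [Function.comp_apply, Fin.cons_zero] at h0
  rw [h0] at hlt
  exact hlt.asymm hlt'

theorem mem_of_cons_new_comp_eq {β β' : H.Branch N} {n n' : ℕ} {x : Fin n → H.GenericExt N M}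
    {x' : Fin n' → H.GenericExt N M} {P : Set (Fin r → Fin n)} {P' : Set (Fin r → Fin n')}
    {u : Fin r → Fin n} {u' : Fin r → Fin n'} {σ : Equiv.Perm (Fin (r + 1))}
    (hx : Function.Injective x) (hP : ∀ u ∈ P, ∀ σ : Equiv.Perm (Fin r), u ∘ σ ∈ P)
    (hu' : u' ∈ P')
    (h : (Fin.cons (new β n x P) (x ∘ u) : Fin (r + 1) → H.GenericExt N M) ∘ σ =
      Fin.cons (new β' n' x' P') (x' ∘ u')) : u ∈ P := by
  obtain ⟨⟨p, τ⟩, rfl⟩ := Equiv.Perm.decomposeFin.symm.surjective σ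
  obtain rfl : p = 0 := by simpa using perm_zero_of_cons_new_comp h
  have h0 := congrFun h 0
  simp only [Function.comp_apply, Equiv.Perm.decomposeFin_symm_apply_zero, Fin.cons_zero,
    new.injEq] at h0
  obtain ⟨rfl, rfl, h1, h2⟩ := h0
  obtain rfl := eq_of_heq h1
  obtain rfl := eq_of_heq h2
  obtain rfl : u ∘ τ = u' := funext fun i => hx (by simpa using congrFun h i.succ)
  simpa [Function.comp_assoc] using hP _ hu' τ.symm

theorem edge_new_iff {β : H.Branch N} {n : ℕ} {x : Fin n → H.GenericExt N M}
    {P : Set (Fin r → Fin n)} (hx : Function.Injective x)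
    (hP : ∀ u ∈ P, ∀ σ : Equiv.Perm (Fin r), u ∘ σ ∈ P) (hP' : ∀ u ∈ P, Function.Injective u)
    (hPE : ∀ u ∈ P, ∀ j : ℕ, (j : ℕ∞) < N →
      (Fin.cons (β.1 j) fun i => color C (x (u i)) j : Fin (r + 1) → Fin (H.size j)) ∈ H.E j)
    (u : Fin r → Fin n) :
    (coloredHypergraph N C).edge (Fin.cons (new β n x P) (x ∘ u)) ↔ u ∈ P := by
  constructor
  · rintro ⟨-, -, ⟨y, hy, -⟩ | ⟨β', n', x', P', u', hu', σ, hz⟩⟩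
    · simpa using congrFun hy 0
    · exact mem_of_cons_new_comp_eq hx hP hu' hz
  · refine fun hu => ⟨Fin.cons_injective_iff.2 ⟨fun hmem => ?_, hx.comp (hP' u hu)⟩,
      fun j hj => ?_, Or.inr ⟨β, n, x, P, u, hu, 1, rfl⟩⟩
    · exact new_notMem_range β x P (Set.range_comp_subset_range u x hmem)
    · convert hPE u hu j hj using 1
      exact funext (Fin.cases rfl fun i => rfl)

/-- From level `l` on, `γ j` is a join of the colors of the family. -/
theorem exists_branch (hH : ∀ j, 0 < H.size j) {n l : ℕ} {c : Fin n → ∀ j, Fin (H.size j)}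
    {P : Set (Fin r → Fin n)} {β : ∀ j, Fin (H.size j)} (hlN : (l : ℕ∞) ≤ N)
    (hjoins : H.HasJoins N l n)
    (hPE : ∀ u ∈ P, ∀ j < l,
      (Fin.cons (β j) fun i => c (u i) j : Fin (r + 1) → Fin (H.size j)) ∈ H.E j) :
    ∃ γ : H.Branch N, (∀ j < l, γ.1 j = β j) ∧ ∀ u ∈ P, ∀ j : ℕ, (j : ℕ∞) < N →
      (Fin.cons (γ.1 j) fun i => c (u i) j : Fin (r + 1) → Fin (H.size j)) ∈ H.E j := by
  have key (j : ℕ) : ∃ s : Fin (H.size j), (N ≤ j → (s : ℕ) = 0) ∧ (j < l → s = β j) ∧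
      ((j : ℕ∞) < N → ∀ u ∈ P,
        (Fin.cons s fun i => c (u i) j : Fin (r + 1) → Fin (H.size j)) ∈ H.E j) := by
    rcases le_or_gt N j with hjN | hjN
    · have hlj : (l : ℕ∞) ≤ j := hlN.trans hjN
      exact ⟨⟨0, hH j⟩, fun _ => rfl, fun h => absurd h (not_lt.2 (by exact_mod_cast hlj)),
        fun h => absurd h (not_lt.2 hjN)⟩
    rcases lt_or_ge j l with hjl | hjl
    · exact ⟨β j, fun h => absurd h (not_le.2 hjN), fun _ => rfl, fun _ u hu => hPE u hu j hjl⟩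
    · obtain ⟨s, hs⟩ := hjoins n le_rfl j hjl hjN fun i => c i j
      exact ⟨s, fun h => absurd h (not_le.2 hjN), fun h => absurd h (not_lt.2 hjl),
        fun _ u _ => hs u⟩
  choose γ hγzero hγβ hγE using key
  exact ⟨⟨γ, hγzero⟩, hγβ, fun u hu j hj => hγE j hj u hu⟩

theorem isGeneric (hH : H.IsAmple) (hC : C.IsBase N) : (coloredHypergraph N C).IsGeneric N where
  symm := by
    rintro σ z ⟨h1, h2, h3⟩
    refine ⟨h1.comp σ.injective, fun j hj => hH.symm j σ _ (h2 j hj), ?_⟩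
    rcases h3 with ⟨x, rfl, he⟩ | ⟨β, n, x, P, u, hu, τ, hz⟩
    · exact Or.inl ⟨x ∘ σ, rfl, hC.symm σ x he⟩
    · exact Or.inr ⟨β, n, x, P, u, hu, σ⁻¹ * τ, by rw [← hz]; funext i; simp⟩
  inj z hz := hz.1
  compat z hz := hz.2.1
  zero z j hj := by
    cases z with
    | base a => exact hC.zero a j hj
    | new β n x P => exact β.2 j hj
  extension := by
    intro n x P l β hx hlN hjoins hP hP' hPE
    obtain ⟨γ, hγβ, hγE⟩ := exists_branch (c := fun i => color C (x i)) hH.size_pos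
      hlN hjoins hPE
    exact ⟨new γ n x P, new_notMem_range γ x P, hγβ, edge_new_iff hx hP hP' hγE⟩

end GenericExt

/-! ### Models as colored hypergraphs -/

variable {N : ℕ∞}

section Realize

variable {M : Type*} [(H.language N).Structure M]

/-- The interpretation of the predicate `Q η`. -/
def QRel (η : H.Node N) (a : M) : Prop :=
  Structure.RelMap (L := H.language N) (Rel.Q η : H.Rel N 1) fun _ : Fin 1 => a

variable (H N) in
/-- The interpretation of the relation `R`. -/
def RRel (x : Fin (r + 1) → M) : Prop :=
  Structure.RelMap (L := H.language N) (Rel.R : H.Rel N (r + 1)) x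

theorem realize_predQ {η : H.Node N} {n : ℕ} {i : Fin n} {v : Empty → M} {xs : Fin n → M} :
    (predQ η i).Realize v xs ↔ QRel η (xs i) :=
  Iff.rfl

theorem realize_relR {n : ℕ} {s : Fin (r + 1) → Fin n} {v : Empty → M} {xs : Fin n → M} :
    (H.relR N s).Realize v xs ↔ H.RRel N (xs ∘ s) :=
  Iff.rfl

theorem realize_alls_iff {n : ℕ} {φ : (H.language N).BoundedFormula Empty n} :
    M ⊨ φ.alls ↔ ∀ xs : Fin n → M, φ.Realize default xs :=
  BoundedFormula.realize_alls

variable (H N M) in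
/-- The axioms of `T₀`, read in the structure `M`. -/
structure IsBaseModel : Prop where
  symm : ∀ (σ : Equiv.Perm (Fin (r + 1))) (x : Fin (r + 1) → M), H.RRel N x → H.RRel N (x ∘ σ)
  irrefl : ∀ i j : Fin (r + 1), i ≠ j → ∀ x : Fin (r + 1) → M, x i = x j → ¬ H.RRel N x
  root : ∀ a : M, QRel (H.root N) a
  of_prefix : ∀ η ν : H.Node N, η.1 <+: ν.1 → ∀ a : M, QRel ν a → QRel η a
  disjoint : ∀ (η : H.Node N) (h : ((η.1.length + 1 : ℕ) : ℕ∞) ≤ N)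
    (i j : Fin (H.size η.1.length)), i ≠ j →
      ∀ a : M, ¬ (QRel (η.child h i) a ∧ QRel (η.child h j) a)
  cover : ∀ (η : H.Node N) (h : ((η.1.length + 1 : ℕ) : ℕ∞) ≤ N), ∀ a : M, QRel η a →
    ∃ i, QRel (η.child h i) a
  compat : ∀ (η : Fin (r + 1) → H.Node N) (n : ℕ) (h : ∀ i, n < (η i).1.length),
    (fun i => (η i).vertex n (h i)) ∉ H.E n → ∀ x : Fin (r + 1) → M,
      (∀ i, QRel (η i) (x i)) → ¬ H.RRel N x

theorem models_baseTheory_iff : M ⊨ H.baseTheory N ↔ H.IsBaseModel N M := by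
  simp only [baseTheory, Theory.model_union_iff]
  simp only [Theory.model_iff, Set.mem_ofPred_eq, Set.mem_singleton_iff, forall_exists_index,
    and_imp, forall_eq, forall_eq_apply_imp_iff, @forall_comm (H.language N).Sentence,
    realize_alls_iff, BoundedFormula.realize_imp, BoundedFormula.realize_not,
    BoundedFormula.realize_inf, BoundedFormula.realize_iSup, BoundedFormula.realize_iInf,
    BoundedFormula.realize_bdEqual, realize_predQ, realize_relR]
  constructor
  · rintro ⟨⟨⟨⟨⟨⟨symm, irrefl⟩, root⟩, of_prefix⟩, disjoint⟩, cover⟩, compat⟩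
    exact ⟨symm, irrefl, fun a => root fun _ => a, fun η ν h a => of_prefix η ν h fun _ => a,
      fun η h i j hij a => disjoint η h i j hij fun _ => a, fun η h a => cover η h fun _ => a,
      compat⟩
  · intro h
    exact ⟨⟨⟨⟨⟨⟨h.symm, h.irrefl⟩, fun _ => h.root _⟩, fun η ν hην _ => h.of_prefix η ν hην _⟩,
      fun η hη i j hij _ => h.disjoint η hη i j hij _⟩, fun η hη _ => h.cover η hη _⟩, h.compat⟩

end Realize

namespace Node

variable {η ν : H.Node N} {j l : ℕ}

/-- The node of length `l` with prescribed vertices. -/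
def ofFn (l : ℕ) (hl : (l : ℕ∞) ≤ N) (β : ∀ j : Fin l, Fin (H.size j)) : H.Node N :=
  ⟨List.ofFn fun j => (β j : ℕ), fun n hn => by simp, by simpa using hl⟩

theorem coe_lt (hj : j < η.1.length) : (j : ℕ∞) < N :=
  lt_of_lt_of_le (by exact_mod_cast hj) η.2.2

theorem vertex_child_last (h : ((η.1.length + 1 : ℕ) : ℕ∞) ≤ N) (i : Fin (H.size η.1.length))
    (h' : η.1.length < (η.child h i).1.length) : (η.child h i).vertex η.1.length h' = i :=
  Fin.ext (by simp [child, vertex])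

theorem vertex_of_prefix (h : η.1 <+: ν.1) (hj : j < η.1.length) :
    ν.vertex j (hj.trans_le h.length_le) = η.vertex j hj :=
  Fin.ext (h.getElem hj).symm

theorem exists_prefix (h : l ≤ ν.1.length) : ∃ η : H.Node N, η.1 <+: ν.1 ∧ η.1.length = l := by
  refine ⟨⟨ν.1.take l, fun n hn => ?_, le_trans (by simp) ν.2.2⟩, List.take_prefix _ _, by simp [h]⟩
  rw [List.getElem_take]
  exact ν.2.1 n _

theorem exists_child_eq (h : ν.1.length = l + 1) :
    ∃ (η : H.Node N) (hη : ((η.1.length + 1 : ℕ) : ℕ∞) ≤ N) (i : Fin (H.size η.1.length)),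
      η.1.length = l ∧ η.child hη i = ν := by
  obtain ⟨η, hην, rfl⟩ := exists_prefix (ν := ν) (l := l) (by omega)
  have hlt : η.1.length < ν.1.length := by omega
  refine ⟨η, h ▸ ν.2.2, ν.vertex _ hlt, rfl, Subtype.ext ?_⟩
  calc η.1 ++ [ν.1[η.1.length] ] = ν.1.take (η.1.length + 1) := by
        rw [List.take_succ_eq_append_getElem hlt, ← List.prefix_iff_eq_take.1 hην]
    _ = ν.1 := List.take_of_length_le h.le

end Node

namespace IsBaseModel

variable {M : Type*} [(H.language N).Structure M] {a : M} {η ν : H.Node N}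

theorem exists_node (hM : H.IsBaseModel N M) (a : M) (l : ℕ) (hl : (l : ℕ∞) ≤ N) :
    ∃ η : H.Node N, η.1.length = l ∧ QRel η a := by
  induction l with
  | zero => exact ⟨H.root N, rfl, hM.root a⟩
  | succ l ih =>
    obtain ⟨η, rfl, hη⟩ := ih (le_trans (by exact_mod_cast Nat.le_succ l) hl)
    obtain ⟨i, hi⟩ := hM.cover η hl a hη
    exact ⟨_, by simp [Node.child], hi⟩

theorem eq_of_length_eq (hM : H.IsBaseModel N M) (h : η.1.length = ν.1.length)
    (hη : QRel η a) (hν : QRel ν a) : η = ν := by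
  obtain ⟨l, hl⟩ : ∃ l, η.1.length = l := ⟨_, rfl⟩
  induction l generalizing η ν with
  | zero =>
    exact Subtype.ext ((List.length_eq_zero_iff.1 hl).trans
      (List.length_eq_zero_iff.1 (h.symm.trans hl)).symm)
  | succ l ih =>
    obtain ⟨κ, hκ, i, hκl, rfl⟩ := Node.exists_child_eq hl
    obtain ⟨κ', hκ', i', hκl', rfl⟩ := Node.exists_child_eq (h.symm.trans hl)
    obtain rfl : κ = κ' := ih (hκl.trans hκl'.symm)
      (hM.of_prefix _ _ (List.prefix_append _ _) a hη)
      (hM.of_prefix _ _ (List.prefix_append _ _) a hν) hκl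
    by_contra hne
    exact hM.disjoint κ hκ i i' (fun hi => hne (by rw [hi])) a ⟨hη, hν⟩

theorem vertex_eq (hM : H.IsBaseModel N M) (hη : QRel η a) (hν : QRel ν a) {j : ℕ}
    (hj : j < η.1.length) (hj' : j < ν.1.length) : η.vertex j hj = ν.vertex j hj' := by
  obtain ⟨η', hη', hηl⟩ := Node.exists_prefix (Nat.succ_le_of_lt hj)
  obtain ⟨ν', hν', hνl⟩ := Node.exists_prefix (Nat.succ_le_of_lt hj')
  obtain rfl := hM.eq_of_length_eq (hηl.trans hνl.symm) (hM.of_prefix _ _ hη' a hη)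
    (hM.of_prefix _ _ hν' a hν)
  rw [Node.vertex_of_prefix hη' (by omega), Node.vertex_of_prefix hν' (by omega)]

theorem exists_color (hM : H.IsBaseModel N M) (hH : ∀ j, 0 < H.size j) (a : M) (j : ℕ) :
    ∃ s : Fin (H.size j), (N ≤ j → (s : ℕ) = 0) ∧
      ∀ (η : H.Node N) (hj : j < η.1.length), QRel η a → η.vertex j hj = s := by
  rcases lt_or_ge (j : ℕ∞) N with hj | hj
  · obtain ⟨ν, hν, hνa⟩ := hM.exists_node a (j + 1) (by exact_mod_cast Order.add_one_le_of_lt hj)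
    exact ⟨ν.vertex j (by omega), fun h => absurd hj (not_lt.2 h),
      fun η hη hηa => hM.vertex_eq hηa hνa _ _⟩
  · exact ⟨⟨0, hH j⟩, fun _ => rfl, fun η hη _ => absurd (Node.coe_lt hη) (not_lt.2 hj)⟩

theorem exists_color_iff (hM : H.IsBaseModel N M) (hH : ∀ j, 0 < H.size j) :
    ∃ color : M → ∀ j, Fin (H.size j), (∀ a (j : ℕ), N ≤ j → (color a j : ℕ) = 0) ∧
      ∀ (η : H.Node N) (a : M),
        QRel η a ↔ ∀ j (h : j < η.1.length), η.vertex j h = color a j := by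
  choose color hzero hcolor using hM.exists_color hH
  refine ⟨color, hzero, fun η a => ⟨fun h j hj => hcolor a j η hj h, fun h => ?_⟩⟩
  obtain ⟨ν, hν, hνa⟩ := hM.exists_node a η.1.length η.2.2
  obtain rfl : ν = η := Subtype.ext (List.ext_getElem hν fun n hn hn' =>
    congrArg Fin.val ((hcolor a n ν hn hνa).trans (h n hn').symm))
  exact hνa

end IsBaseModel

namespace ColoredHypergraph

variable {M : Type*} {C : H.ColoredHypergraph M}

/-- The structure given by a colored hypergraph. -/
@[reducible] def str (C : H.ColoredHypergraph M) (N : ℕ∞) : (H.language N).Structure M where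
  funMap := fun f => Empty.elim f
  RelMap := fun {n} (s : H.Rel N n) => match n, s with
    | _, .R => fun x => C.edge x
    | _, .Q η => fun x => ∀ j (h : j < η.1.length), η.vertex j h = C.color (x 0) j

theorem QRel_str_iff {η : H.Node N} {a : M} :
    letI := C.str N
    QRel η a ↔ ∀ j (h : j < η.1.length), η.vertex j h = C.color a j :=
  Iff.rfl

theorem RRel_str_iff {x : Fin (r + 1) → M} :
    letI := C.str N
    H.RRel N x ↔ C.edge x :=
  Iff.rfl

theorem QRel_ofFn_iff {l : ℕ} {hl : (l : ℕ∞) ≤ N} {β : ∀ j : Fin l, Fin (H.size j)} {a : M} :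
    letI := C.str N
    QRel (Node.ofFn l hl β) a ↔ ∀ j : Fin l, C.color a j = β j := by
  rw [QRel_str_iff]
  constructor
  · intro h j
    rw [← h j (by simp [Node.ofFn])]
    exact Fin.ext (by simp [Node.ofFn, Node.vertex])
  · intro h j hj
    have hj' : j < l := by simpa [Node.ofFn] using hj
    rw [h ⟨j, hj'⟩]
    exact Fin.ext (by simp [Node.ofFn, Node.vertex])

theorem str_eq_of_iff [S : (H.language N).Structure M] (hedge : ∀ x, H.RRel N x ↔ C.edge x)
    (hcolor : ∀ (η : H.Node N) (a : M),
      QRel η a ↔ ∀ j (h : j < η.1.length), η.vertex j h = C.color a j) : S = C.str N := by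
  ext n s x
  · exact (s : Empty).elim
  · match n, s with
    | _, .R => exact hedge x
    | _, .Q η =>
      have hx : x = fun _ => x 0 := funext fun i => congrArg x (Subsingleton.elim i 0)
      rw [hx]
      exact hcolor η (x 0)

theorem IsBase.models (hC : C.IsBase N) :
    letI := C.str N
    M ⊨ H.baseTheory N := by
  let := C.str N
  refine models_baseTheory_iff.2
    { symm := hC.symm
      irrefl := fun i j hij x hx he => hij (hC.inj x he hx)
      root := fun a j hj => absurd hj (by simp [root])
      of_prefix := fun η ν h a hν j hj => by
        rw [← hν j (hj.trans_le h.length_le), Node.vertex_of_prefix h]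
      disjoint := ?_
      cover := ?_
      compat := ?_ }
  · rintro η h i j hij a ⟨hi, hj⟩
    have hlt (i) : η.1.length < (η.child h i).1.length := by simp [Node.child]
    refine hij ?_
    rw [← Node.vertex_child_last h i (hlt i), hi, ← hj _ (hlt j), Node.vertex_child_last]
  · intro η h a ha
    refine ⟨C.color a η.1.length, fun j hj => ?_⟩
    rcases Nat.lt_succ_iff_lt_or_eq.1 (show j < η.1.length + 1 by simpa [Node.child] using hj)
      with hlt | rfl
    · rw [← ha j hlt]
      exact Node.vertex_of_prefix (List.prefix_append _ _) hlt
    · exact Node.vertex_child_last _ _ _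
  · intro η n hn hE x hx he
    refine hE ?_
    convert hC.compat x he n (Node.coe_lt (hn 0)) using 1
    exact funext fun i => hx i n (hn i)

theorem exists_isBase_of_models (hH : ∀ j, 0 < H.size j) [S : (H.language N).Structure M]
    (hM : M ⊨ H.baseTheory N) : ∃ C : H.ColoredHypergraph M, C.IsBase N ∧ S = C.str N := by
  replace hM := models_baseTheory_iff.1 hM
  obtain ⟨color, hzero, hcolor⟩ := hM.exists_color_iff hH
  refine ⟨⟨color, H.RRel N⟩, ⟨hM.symm, fun x hx i j hij => ?_, fun x hx j hj => ?_, hzero⟩,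
    str_eq_of_iff (fun _ => Iff.rfl) hcolor⟩
  · by_contra hne
    exact hM.irrefl i j hne x hij hx
  · by_contra hE
    choose η hη hηx using fun i =>
      hM.exists_node (x i) (j + 1) (by exact_mod_cast Order.add_one_le_of_lt hj)
    have hjη (i) : j < (η i).1.length := by rw [hη]; omega
    refine hM.compat η j hjη (fun hmem => hE ?_) x hηx hx
    convert hmem using 1
    exact funext fun i => ((hcolor _ _).1 (hηx i) j (hjη i)).symm

end ColoredHypergraph

/-! ### The extension axioms -/

section Axioms

variable {n l : ℕ} (hl : (l : ℕ∞) ≤ N) (β : ∀ j, Fin (H.size j)) (γ : Fin n → ∀ j, Fin (H.size j))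
  (P : Set (Fin r → Fin n))

/-- The variables are distinct and have the colors `γ` at the levels below `l`. -/
noncomputable def colorFormula : (H.language N).BoundedFormula Empty n :=
  (BoundedFormula.iInf fun i : Fin n => predQ (Node.ofFn l hl fun j => γ i j) i) ⊓
    BoundedFormula.iInf fun p : {p : Fin n × Fin n // p.1 ≠ p.2} =>
      ∼(Term.bdEqual (&p.1.1) (&p.1.2))

open Classical in
/-- The last variable differs from the others, has the color `β` at the levels below `l`, and is
joined to exactly those `r`-tuples of the others that belong to `P`. -/
noncomputable def joinFormula : (H.language N).BoundedFormula Empty (n + 1) :=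
  predQ (Node.ofFn l hl fun j => β j) (Fin.last n) ⊓
    ((BoundedFormula.iInf fun i : Fin n => ∼(Term.bdEqual (&(Fin.last n)) (&i.castSucc))) ⊓
      BoundedFormula.iInf fun u : Fin r → Fin n =>
        if u ∈ P then H.relR N (Fin.cons (Fin.last n) (Fin.castSucc ∘ u))
        else ∼(H.relR N (Fin.cons (Fin.last n) (Fin.castSucc ∘ u))))

/-- The instance of the extension property `ColoredHypergraph.IsGeneric` for families with the
colors `γ`. -/
noncomputable def extensionAxiom : (H.language N).Sentence :=
  (colorFormula hl γ ⟹ ∃' (joinFormula hl β P)).alls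

variable (H N l) in
/-- The consistency condition on the data of an extension axiom. -/
structure IsAdmissible : Prop where
  joins : H.HasJoins N l n
  symm : ∀ u ∈ P, ∀ σ : Equiv.Perm (Fin r), u ∘ σ ∈ P
  inj : ∀ u ∈ P, Function.Injective u
  compat : ∀ u ∈ P, ∀ j < l,
    (Fin.cons (β j) fun i => γ (u i) j : Fin (r + 1) → Fin (H.size j)) ∈ H.E j

end Axioms

variable (H N) in
/-- The model completion of the theory `T₀` of level `N`: besides `T₀` it consists of the extension
axioms with consistent data. -/
def genericTheory : (H.language N).Theory :=
  H.baseTheory N ∪ {φ | ∃ (n l : ℕ) (hl : (l : ℕ∞) ≤ N) (β : ∀ j, Fin (H.size j))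
    (γ : Fin n → ∀ j, Fin (H.size j)) (P : Set (Fin r → Fin n)),
    IsAdmissible H N l β γ P ∧ φ = extensionAxiom hl β γ P}

namespace ColoredHypergraph

variable {M : Type*} {C : H.ColoredHypergraph M} {n l : ℕ} {hl : (l : ℕ∞) ≤ N}
  {β : ∀ j, Fin (H.size j)} {γ : Fin n → ∀ j, Fin (H.size j)} {P : Set (Fin r → Fin n)}

theorem realize_colorFormula {v : Empty → M} {x : Fin n → M} :
    letI := C.str N
    (colorFormula hl γ).Realize v x ↔
      Function.Injective x ∧ ∀ i, ∀ j < l, C.color (x i) j = γ i j := by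
  simp only [colorFormula, BoundedFormula.realize_inf, BoundedFormula.realize_iInf, realize_predQ,
    BoundedFormula.realize_not, BoundedFormula.realize_bdEqual, QRel_ofFn_iff, Term.realize_var,
    Sum.elim_inr, Function.comp_apply]
  rw [and_comm]
  refine and_congr ⟨fun h i j hij => ?_, fun h p hp => p.2 (h hp)⟩
    (forall_congr' fun i => ⟨fun h j hj => h ⟨j, hj⟩, fun h j => h j j.2⟩)
  by_contra hne
  exact h ⟨(i, j), hne⟩ hij

theorem realize_joinFormula {v : Empty → M} {x : Fin n → M} {y : M} :
    letI := C.str N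
    (joinFormula hl β P).Realize v (Fin.snoc x y : Fin (n + 1) → M) ↔
      (∀ j < l, C.color y j = β j) ∧ y ∉ Set.range x ∧
        ∀ u : Fin r → Fin n, C.edge (Fin.cons y (x ∘ u)) ↔ u ∈ P := by
  let := C.str N
  simp only [joinFormula, BoundedFormula.realize_inf, BoundedFormula.realize_iInf, realize_predQ,
    BoundedFormula.realize_not, BoundedFormula.realize_bdEqual, QRel_ofFn_iff, Term.realize_var,
    Sum.elim_inr, Function.comp_apply, Fin.snoc_last, Fin.snoc_castSucc]
  refine and_congr ⟨fun h j hj => h ⟨j, hj⟩, fun h j => h j j.2⟩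
    (and_congr (by simp [eq_comm]) (forall_congr' fun u => ?_))
  have hu : (Fin.snoc x y : Fin (n + 1) → M) ∘ (Fin.cons (Fin.last n) (Fin.castSucc ∘ u)) =
      Fin.cons y (x ∘ u) := by
    funext i
    refine Fin.cases ?_ (fun i => ?_) i <;> simp
  split_ifs with h
  · rw [realize_relR, hu, RRel_str_iff, iff_true_right h]
  · rw [BoundedFormula.realize_not, realize_relR, hu, RRel_str_iff, iff_false_right h]

theorem models_extensionAxiom_iff :
    letI := C.str N
    M ⊨ extensionAxiom hl β γ P ↔
      ∀ x : Fin n → M, Function.Injective x → (∀ i, ∀ j < l, C.color (x i) j = γ i j) →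
        ∃ y, (∀ j < l, C.color y j = β j) ∧ y ∉ Set.range x ∧
          ∀ u : Fin r → Fin n, C.edge (Fin.cons y (x ∘ u)) ↔ u ∈ P := by
  let := C.str N
  rw [extensionAxiom, realize_alls_iff]
  simp only [BoundedFormula.realize_imp, BoundedFormula.realize_ex, realize_colorFormula,
    realize_joinFormula, and_imp]

theorem IsGeneric.models (hC : C.IsGeneric N) :
    letI := C.str N
    M ⊨ H.genericTheory N := by
  let := C.str N
  rw [genericTheory, Theory.model_union_iff]
  refine ⟨hC.toIsBase.models, (Theory.model_iff _).2 ?_⟩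
  rintro _ ⟨n, l, hl, β, γ, P, hP, rfl⟩
  refine models_extensionAxiom_iff.2 fun x hx hγ => ?_
  obtain ⟨y, hyx, hyc, hye⟩ := hC.extension x P l β hx hl hP.joins hP.symm hP.inj
    fun u hu j hj => by simpa only [hγ _ j hj] using hP.compat u hu j hj
  exact ⟨y, hyc, hyx, hye⟩

theorem IsBase.isGeneric_of_models (hC : C.IsBase N) :
    letI := C.str N
    M ⊨ H.genericTheory N → C.IsGeneric N := by
  let := C.str N
  refine fun hM => ⟨hC, fun x P l β hx hl hjoins hsymm hinj hcompat => ?_⟩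
  have hmem : extensionAxiom hl β (fun i => C.color (x i)) P ∈ H.genericTheory N :=
    Or.inr ⟨_, l, hl, β, _, P, ⟨hjoins, hsymm, hinj, hcompat⟩, rfl⟩
  obtain ⟨y, hyc, hyx, hye⟩ :=
    models_extensionAxiom_iff.1 (hM.realize_of_mem _ hmem) x hx fun _ _ _ => rfl
  exact ⟨y, hyx, hyc, hye⟩

theorem exists_isGeneric_of_models (hH : H.IsAmple) [S : (H.language N).Structure M]
    (hM : M ⊨ H.genericTheory N) : ∃ C : H.ColoredHypergraph M, C.IsGeneric N ∧ S = C.str N := by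
  obtain ⟨C, hC, rfl⟩ := exists_isBase_of_models hH.size_pos (hM.mono Set.subset_union_left)
  exact ⟨C, hC.isGeneric_of_models hM, rfl⟩

end ColoredHypergraph

/-! ### The level of a formula -/

theorem exists_eq_var {V : Type*} (t : (H.language N).Term V) : ∃ a, t = Term.var a := by
  cases t with
  | var a => exact ⟨a, rfl⟩
  | func f ts => exact Empty.elim f

namespace ColoredHypergraph

theorem IsGeneric.exists_agree_snoc {α M₁ M₂ : Type*} [Finite α] {N₁ N₂ : ℕ∞} {n l : ℕ}
    {C₁ : H.ColoredHypergraph M₁} {C₂ : H.ColoredHypergraph M₂} {c : α → M₁} {d : α → M₂}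
    {x : Fin n → M₁} {y : Fin n → M₂} (h₂ : C₂.IsGeneric N₂) (h₁ : C₁.IsBase N₁)
    (hN : min N₁ l = min N₂ l) (h : Agree l C₁ C₂ (Sum.elim c x) (Sum.elim d y))
    (hl : H.HasJoins ⊤ l (Nat.card (α ⊕ Fin n))) (a : M₁) :
    ∃ b, Agree l C₁ C₂ (Sum.elim c (Fin.snoc x a : Fin (n + 1) → M₁))
      (Sum.elim d (Fin.snoc y b : Fin (n + 1) → M₂)) := by
  obtain ⟨b, hb⟩ := h₂.exists_agree_option h₁ hN h hl a
  refine ⟨b, ?_⟩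
  convert hb.comp (Sum.elim (some ∘ Sum.inl) (Fin.snoc (some ∘ Sum.inr) none)) using 1 <;>
    ext (i | i) <;> first | rfl | refine Fin.lastCases ?_ (fun i => ?_) i <;> simp

variable (N) in
/-- Modulo the theories `genericTheory H N'`, the formula `φ` depends only on the colors below
level `l`. Since `N'` may vary, this also compares the theories of different levels. -/
def HasLevel {α : Type w} {n : ℕ} (φ : (H.language N).BoundedFormula α n) (l : ℕ) : Prop :=
  ∀ {N₁ N₂ : ℕ∞} {M₁ : Type u} {M₂ : Type v} {C₁ : H.ColoredHypergraph M₁}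
    {C₂ : H.ColoredHypergraph M₂} {c : α → M₁} {d : α → M₂} {x : Fin n → M₁} {y : Fin n → M₂},
    C₁.IsGeneric N₁ → C₂.IsGeneric N₂ → min N₁ l = min N₂ l →
    Agree l C₁ C₂ (Sum.elim c x) (Sum.elim d y) →
    (letI := C₁.str N; φ.Realize c x ↔ letI := C₂.str N; φ.Realize d y)

theorem HasLevel.mono {α : Type w} {n l l' : ℕ} {φ : (H.language N).BoundedFormula α n}
    (h : HasLevel.{u, v} N φ l) (hl : l ≤ l') : HasLevel.{u, v} N φ l' := by
  intro N₁ N₂ M₁ M₂ C₁ C₂ c d x y h₁ h₂ hN hcd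
  refine h h₁ h₂ ?_ (hcd.mono hl)
  have hl' : (l : ℕ∞) ≤ l' := by exact_mod_cast hl
  rw [← min_eq_right hl', ← min_assoc, ← min_assoc, hN]

theorem HasLevel.all {α : Type w} [Finite α] {n l : ℕ}
    {φ : (H.language N).BoundedFormula α (n + 1)} (h : HasLevel.{u, v} N φ l)
    (hl : H.HasJoins ⊤ l (Nat.card (α ⊕ Fin n))) : HasLevel.{u, v} N φ.all l := by
  intro N₁ N₂ M₁ M₂ C₁ C₂ c d x y h₁ h₂ hN hcd
  constructor
  · intro hφ b
    obtain ⟨a, ha⟩ := h₁.exists_agree_snoc h₂.toIsBase hN.symm hcd.symm hl b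
    exact (h h₁ h₂ hN ha.symm).1 (hφ a)
  · intro hφ a
    obtain ⟨b, hb⟩ := h₂.exists_agree_snoc h₁.toIsBase hN hcd hl a
    exact (h h₁ h₂ hN hb).2 (hφ b)

theorem exists_hasLevel (hH : H.IsAmple) {α : Type w} [Finite α] {n : ℕ}
    (φ : (H.language N).BoundedFormula α n) : ∃ l, HasLevel.{u, v} N φ l := by
  induction φ with
  | falsum => exact ⟨0, fun _ _ _ _ => Iff.rfl⟩
  | equal t₁ t₂ =>
    obtain ⟨a₁, rfl⟩ := exists_eq_var t₁
    obtain ⟨a₂, rfl⟩ := exists_eq_var t₂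
    exact ⟨0, fun _ _ _ h => h.eq_iff a₁ a₂⟩
  | rel s ts =>
    choose u hu using fun i => exists_eq_var (ts i)
    obtain rfl : ts = fun i => Term.var (u i) := funext hu
    change H.Rel N _ at s
    cases s with
    | R => exact ⟨0, fun _ _ _ h => h.edge_iff u⟩
    | Q η =>
      refine ⟨η.1.length, fun _ _ _ h => forall_congr' fun j => forall_congr' fun hj => ?_⟩
      exact iff_of_eq (congrArg _ (h.color_eq (u 0) j hj))
  | imp φ ψ ihφ ihψ =>
    obtain ⟨l, hl⟩ := ihφ
    obtain ⟨l', hl'⟩ := ihψ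
    exact ⟨max l l', fun h₁ h₂ hN h => imp_congr (hl.mono (le_max_left l l') h₁ h₂ hN h)
      (hl'.mono (le_max_right l l') h₁ h₂ hN h)⟩
  | all φ ih =>
    obtain ⟨l, hl⟩ := ih
    obtain ⟨l', hl'⟩ := hH.exists_hasJoins (Nat.card (α ⊕ Fin _))
    have hφ : HasLevel.{u, v} N φ (max l l') := HasLevel.mono hl (le_max_left l l')
    exact ⟨max l l', HasLevel.all hφ (hl'.mono le_rfl (le_max_right l l') le_rfl)⟩

theorem HasLevel.formula_realize_iff {α : Type w} {l : ℕ} {φ : (H.language N).Formula α}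
    (h : HasLevel.{u, v} N φ l) {N₁ N₂ : ℕ∞} {M₁ : Type u} {M₂ : Type v}
    {C₁ : H.ColoredHypergraph M₁} {C₂ : H.ColoredHypergraph M₂} {c : α → M₁} {d : α → M₂}
    (h₁ : C₁.IsGeneric N₁) (h₂ : C₂.IsGeneric N₂) (hN : min N₁ l = min N₂ l)
    (hcd : Agree l C₁ C₂ c d) :
    (letI := C₁.str N; φ.Realize c ↔ letI := C₂.str N; φ.Realize d) := by
  refine h h₁ h₂ hN ?_
  convert hcd.comp (Sum.elim id Fin.elim0) using 1 <;> ext (_ | i) <;> first | rfl | exact i.elim0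

theorem realize_iff_of_agree (hH : H.IsAmple) {α : Type w} (φ : (H.language N).Formula α)
    {N' : ℕ∞} {M₁ : Type u} {M₂ : Type v} {C₁ : H.ColoredHypergraph M₁}
    {C₂ : H.ColoredHypergraph M₂} (h₁ : C₁.IsGeneric N') (h₂ : C₂.IsGeneric N') {c : α → M₁}
    {d : α → M₂} (h : ∀ l, Agree l C₁ C₂ c d) :
    (letI := C₁.str N; φ.Realize c ↔ letI := C₂.str N; φ.Realize d) := by
  classical
  obtain ⟨l, hl⟩ := exists_hasLevel hH
    (BoundedFormula.restrictFreeVar φ (id : φ.freeVarFinset → _) : (H.language N).Formula _)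
  have hfin := hl.formula_realize_iff h₁ h₂ rfl ((h l).comp ((↑) : φ.freeVarFinset → α))
  let := C₁.str N
  let := C₂.str N
  exact (BoundedFormula.realize_restrictFreeVar (f := id) c fun _ => rfl).symm.trans
    (hfin.trans (BoundedFormula.realize_restrictFreeVar (f := id) d fun _ => rfl))

theorem agree_of_realize_isQF {V M₁ M₂ : Type*} {C₁ : H.ColoredHypergraph M₁}
    {C₂ : H.ColoredHypergraph M₂} (h₁ : C₁.IsBase N) (h₂ : C₂.IsBase N) {c : V → M₁}
    {d : V → M₂} (h : ∀ φ : (H.language N).Formula V, BoundedFormula.IsQF φ →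
      (letI := C₁.str N; φ.Realize c → letI := C₂.str N; φ.Realize d)) (l : ℕ) :
    Agree l C₁ C₂ c d := by
  have hiff (φ : (H.language N).Formula V) (hφ : φ.IsAtomic) :
      (letI := C₁.str N; φ.Realize c ↔ letI := C₂.str N; φ.Realize d) :=
    ⟨h φ hφ.isQF, fun hd => by_contra fun hc => h φ.not hφ.isQF.not hc hd⟩
  refine ⟨fun i j => hiff (Term.equal (Term.var i) (Term.var j)) (.equal _ _), fun i => ?_,
    fun u => hiff (Relations.formula (L := H.language N) (Rel.R : H.Rel N (r + 1))
      fun i => Term.var (u i)) (.rel _ _)⟩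
  refine h₁.color_eq_of_min_eq h₂ rfl fun j _ hj => ?_
  have hj' : ((j + 1 : ℕ) : ℕ∞) ≤ N := by exact_mod_cast Order.add_one_le_of_lt hj
  have hQ := hiff (Relations.formula (L := H.language N)
    (Rel.Q (Node.ofFn (j + 1) hj' fun j => C₁.color (c i) j) : H.Rel N 1) fun _ => Term.var i)
    (.rel _ _)
  exact (QRel_ofFn_iff.1 (hQ.1 (QRel_ofFn_iff.2 fun _ => rfl)) ⟨j, j.lt_succ_self⟩).symm

end ColoredHypergraph

/-! ### The model completion, its uniqueness and completeness -/

open ColoredHypergraph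

/-- The hypergraph without edges on `M`, all of whose vertices carry the branch `0`. -/
def discreteHypergraph (hH : ∀ j, 0 < H.size j) (M : Type*) : H.ColoredHypergraph M :=
  ⟨fun _ j => ⟨0, hH j⟩, fun _ => False⟩

theorem isBase_discreteHypergraph (hH : ∀ j, 0 < H.size j) (M : Type*) :
    (discreteHypergraph hH M).IsBase N where
  symm _ _ h := h
  inj _ h := h.elim
  compat _ h := h.elim
  zero _ _ _ := rfl

theorem GenericExt.nonempty (hH : ∀ j, 0 < H.size j) (M : Type w) : Nonempty (H.GenericExt N M) :=
  ⟨.new ⟨fun j => ⟨0, hH j⟩, fun _ _ => rfl⟩ 0 Fin.elim0 ∅⟩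

variable (N) in
theorem exists_isGeneric (hH : H.IsAmple) :
    ∃ (M : Type w) (_ : Nonempty M) (C : H.ColoredHypergraph M), C.IsGeneric N :=
  ⟨_, GenericExt.nonempty hH.size_pos PEmpty, _,
    GenericExt.isGeneric hH (isBase_discreteHypergraph hH.size_pos _)⟩

/-- The embedding of a colored hypergraph into its free generic extension. -/
def GenericExt.embedding {M : Type w} {C : H.ColoredHypergraph M} (hC : C.IsBase N) :
    letI := C.str N
    letI := (GenericExt.coloredHypergraph N C).str N
    M ↪[H.language N] H.GenericExt N M :=
  letI := C.str N
  letI := (GenericExt.coloredHypergraph N C).str N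
  { toFun := .base
    inj' := GenericExt.base_injective
    map_fun' := fun f => Empty.elim f
    map_rel' := fun {n} (s : H.Rel N n) => match n, s with
      | _, .R => GenericExt.edge_base_iff hC
      | _, .Q _ => fun _ => Iff.rfl }

theorem realize_sentence_iff (hH : H.IsAmple) (φ : (H.language N).Sentence) {N' : ℕ∞}
    {M₁ : Type u} {M₂ : Type v} {C₁ : H.ColoredHypergraph M₁}
    {C₂ : H.ColoredHypergraph M₂} (h₁ : C₁.IsGeneric N') (h₂ : C₂.IsGeneric N') :
    (letI := C₁.str N; M₁ ⊨ φ) ↔ (letI := C₂.str N; M₂ ⊨ φ) :=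
  realize_iff_of_agree hH φ h₁ h₂ fun _ => ⟨isEmptyElim, isEmptyElim, fun u => (u 0).elim⟩

theorem isComplete_genericTheory (hH : H.IsAmple) : (H.genericTheory N).IsComplete := by
  rw [Theory.IsComplete.isComplete_iff_models_elementarily_equivalent]
  constructor
  · obtain ⟨M, _, C, hC⟩ := exists_isGeneric.{0} N hH
    let := C.str N
    exact ⟨hC.models.bundled⟩
  · intro M₁ M₂
    obtain ⟨C₁, h₁, hS₁⟩ := exists_isGeneric_of_models hH M₁.is_model
    obtain ⟨C₂, h₂, hS₂⟩ := exists_isGeneric_of_models hH M₂.is_model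
    rw [elementarilyEquivalent_iff]
    intro φ
    rw [hS₁, hS₂]
    exact realize_sentence_iff hH φ h₁ h₂

theorem agree_con_of_models_qfDiagram {M : Type u} [S : (H.language N).Structure M]
    {C : H.ColoredHypergraph M} (hC : C.IsBase N) (hS : S = C.str N) {K : Type v}
    [SK : (H.language N).Structure K] [(H.language N)[[M]].Structure K]
    [((H.language N).lhomWithConstants M).IsExpansionOn K] (hK : K ⊨ (H.language N).qfDiagram M)
    {CK : H.ColoredHypergraph K} (hCK : CK.IsBase N) (hSK : SK = CK.str N) (l : ℕ) :
    Agree l C CK id fun a : M => ((H.language N).con a : K) := by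
  subst hS hSK
  let := C.str N
  let := CK.str N
  exact agree_of_realize_isQF hC hCK (fun φ hφ => realize_con_of_models_qfDiagram hK hφ) l

theorem isModelCompletion_genericTheory (hH : H.IsAmple) :
    IsModelCompletion.{0, 0, w} (H.baseTheory N) (H.genericTheory N) := by
  refine ⟨fun φ hφ => Theory.models_sentence_of_mem (Or.inl hφ), ?_⟩
  rintro ⟨M⟩
  obtain ⟨C, hC, rfl⟩ := exists_isBase_of_models hH.size_pos ‹_›
  let := C.str N
  rw [Theory.IsComplete.isComplete_iff_models_elementarily_equivalent]
  constructor
  · let := (GenericExt.coloredHypergraph N C).str N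
    let f := GenericExt.embedding hC
    have hmod := models_onTheory_union_qfDiagram f (GenericExt.isGeneric hH hC).models
    let := constantsOn.structure f
    have := GenericExt.nonempty (N := N) hH.size_pos M
    exact ⟨hmod.bundled⟩
  · intro K₁ K₂
    let : (H.language N).Structure K₁ := ((H.language N).lhomWithConstants M).reduct K₁
    let : (H.language N).Structure K₂ := ((H.language N).lhomWithConstants M).reduct K₂
    have hK₁ := Theory.model_union_iff.1 K₁.is_model
    have hK₂ := Theory.model_union_iff.1 K₂.is_model
    obtain ⟨C₁, h₁, hS₁⟩ := exists_isGeneric_of_models hH ((LHom.onTheory_model _ _).1 hK₁.1)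
    obtain ⟨C₂, h₂, hS₂⟩ := exists_isGeneric_of_models hH ((LHom.onTheory_model _ _).1 hK₂.1)
    rw [elementarilyEquivalent_iff]
    intro φ
    rw [← Formula.realize_equivSentence_symm_con, ← Formula.realize_equivSentence_symm_con,
      hS₁, hS₂]
    refine realize_iff_of_agree hH _ h₁ h₂ fun l => ?_
    exact (agree_con_of_models_qfDiagram hC rfl hK₁.2 h₁.toIsBase hS₁ l).symm.trans
      (agree_con_of_models_qfDiagram hC rfl hK₂.2 h₂.toIsBase hS₂ l)

theorem isQF_predQ (η : H.Node N) {n : ℕ} (i : Fin n) : (predQ η i).IsQF :=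
  (BoundedFormula.IsAtomic.rel _ _).isQF

theorem isQF_relR {n : ℕ} (s : Fin (r + 1) → Fin n) : (H.relR N s).IsQF :=
  (BoundedFormula.IsAtomic.rel _ _).isQF

theorem isQF_colorFormula {n l : ℕ} (hl : (l : ℕ∞) ≤ N) (γ : Fin n → ∀ j, Fin (H.size j)) :
    (colorFormula hl γ).IsQF :=
  (isQF_iInf fun _ => isQF_predQ _ _).inf
    (isQF_iInf fun _ => (BoundedFormula.IsAtomic.equal _ _).isQF.not)

theorem isQF_joinFormula {n l : ℕ} (hl : (l : ℕ∞) ≤ N) (β : ∀ j, Fin (H.size j))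
    (P : Set (Fin r → Fin n)) : (joinFormula hl β P).IsQF := by
  refine (isQF_predQ _ _).inf ((isQF_iInf fun _ => (BoundedFormula.IsAtomic.equal _ _).isQF.not).inf
    (isQF_iInf fun u => ?_))
  split_ifs
  · exact isQF_relR _
  · exact (isQF_relR _).not

theorem models_genericTheory_of_isModelCompletion (hH : H.IsAmple) {T : (H.language N).Theory}
    (hT : IsModelCompletion.{0, 0, w} (H.baseTheory N) T) {K : Type w} [(H.language N).Structure K]
    [Nonempty K] (hK : K ⊨ T) : K ⊨ H.genericTheory N := by
  have hK₀ : K ⊨ H.baseTheory _ := models_base_of_isModelCompletion hT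
  obtain ⟨C, hC, rfl⟩ := exists_isBase_of_models hH.size_pos hK₀
  let := C.str N
  let := (GenericExt.coloredHypergraph N C).str N
  have hG := GenericExt.isGeneric hH hC
  refine Theory.model_union_iff.2 ⟨hK₀, (Theory.model_iff _).2 ?_⟩
  rintro _ ⟨n, l, hl, β, γ, P, hadm, rfl⟩
  exact models_of_isModelCompletion_of_embedding hT hK hG.toIsBase.models (GenericExt.embedding hC)
    (isQF_colorFormula _ _) (isQF_joinFormula _ _ _)
    (hG.models.realize_of_mem _ (Or.inr ⟨n, l, hl, β, γ, P, hadm, rfl⟩))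

theorem theoryEquiv_of_isModelCompletion (hH : H.IsAmple) {T : (H.language N).Theory}
    (hT : IsModelCompletion.{0, 0, w} (H.baseTheory N) T) : TheoryEquiv T (H.genericTheory N) := by
  intro φ
  constructor
  · intro h
    obtain ⟨M, _, C, hC⟩ := exists_isGeneric.{w} N hH
    let := C.str N
    obtain ⟨K, _, _, hK, -⟩ := exists_embedding_of_isModelCompletion hT hC.toIsBase.models
    have := models_genericTheory_of_isModelCompletion hH hT hK
    exact ((isComplete_genericTheory hH).realize_sentence_iff φ K).1 (h.realize_sentence K)
  · intro h
    refine models_sentence_of_forall.{0, 0, w} fun K _ _ hK => ?_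
    have := models_genericTheory_of_isModelCompletion hH hT hK
    exact h.realize_sentence K

/-! ### Quantifier elimination and the limit -/

/-- The atomic formulas that determine whether tuples indexed by `V` agree up to level `l`. -/
def atomFormula (V : Type*) {l : ℕ} (hl : (l : ℕ∞) ≤ N) :
    (V × V) ⊕ (V × ∀ j : Fin l, Fin (H.size j)) ⊕ (Fin (r + 1) → V) → (H.language N).Formula V
  | .inl p => Term.equal (Term.var p.1) (Term.var p.2)
  | .inr (.inl p) => Relations.formula (L := H.language N)
      (Rel.Q (Node.ofFn l hl p.2) : H.Rel N 1) fun _ => Term.var p.1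
  | .inr (.inr u) => Relations.formula (L := H.language N)
      (Rel.R : H.Rel N (r + 1)) fun i => Term.var (u i)

theorem isQF_atomFormula {V : Type*} {l : ℕ} (hl : (l : ℕ∞) ≤ N) :
    ∀ i, BoundedFormula.IsQF (atomFormula (H := H) V hl i)
  | .inl _ => (BoundedFormula.IsAtomic.equal _ _).isQF
  | .inr (.inl _) => (BoundedFormula.IsAtomic.rel _ _).isQF
  | .inr (.inr _) => (BoundedFormula.IsAtomic.rel _ _).isQF

theorem agree_of_atomFormula {V M₁ M₂ : Type*} {l : ℕ} {hl : (l : ℕ∞) ≤ N}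
    {C₁ : H.ColoredHypergraph M₁} {C₂ : H.ColoredHypergraph M₂} {c : V → M₁} {d : V → M₂}
    (h : ∀ i, (letI := C₁.str N; (atomFormula (H := H) V hl i).Realize c) ↔
      (letI := C₂.str N; (atomFormula (H := H) V hl i).Realize d)) :
    Agree l C₁ C₂ c d where
  eq_iff i j := h (.inl (i, j))
  color_eq i j hj := by
    have hQ := (h (.inr (.inl (i, fun j => C₁.color (c i) j)))).1 (QRel_ofFn_iff.2 fun _ => rfl)
    exact (QRel_ofFn_iff.1 hQ ⟨j, hj⟩).symm
  edge_iff u := h (.inr (.inr u))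

theorem eliminatesQuantifiers_genericTheory (hH : H.IsAmple) :
    EliminatesQuantifiers (H.genericTheory N) := by
  intro n φ
  obtain ⟨l, hl⟩ := exists_hasLevel.{0, 0} hH φ
  obtain ⟨l', hl'⟩ := ENat.ne_top_iff_exists.1
    ((min_le_right N l).trans_lt (ENat.natCast_lt_top l)).ne
  refine exists_isQF_iff_of_finite
    (isQF_atomFormula (V := Fin n) (hl'.trans_le (min_le_left N l))) ?_
  rintro @⟨M₁, _, hM₁, _⟩ @⟨M₂, _, hM₂, _⟩ c d h
  obtain ⟨C₁, h₁, rfl⟩ := exists_isGeneric_of_models hH hM₁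
  obtain ⟨C₂, h₂, rfl⟩ := exists_isGeneric_of_models hH hM₂
  have hcd : Agree l' C₁ C₂ c d := agree_of_atomFormula h
  refine (hl.formula_realize_iff h₁ h₂ rfl ⟨hcd.eq_iff, fun i => ?_, hcd.edge_iff⟩).1
  refine h₁.toIsBase.color_eq_of_min_eq h₂.toIsBase rfl fun j hj hjN => hcd.color_eq i j ?_
  rw [← ENat.natCast_lt_natCast, hl']
  exact lt_min hjN (ENat.natCast_lt_natCast.2 hj)

theorem exists_onTerm_eq {V : Type*} (m : ℕ) (t : (H.language ⊤).Term V) :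
    ∃ s, (H.incl m).onTerm s = t := by
  obtain ⟨a, rfl⟩ := exists_eq_var t
  exact ⟨Term.var a, rfl⟩

theorem exists_onBoundedFormula_eq {α : Type*} {n : ℕ} (φ : (H.language ⊤).BoundedFormula α n) :
    ∃ m₀ : ℕ, ∀ m ≥ m₀, ∃ ψ, (H.incl m).onBoundedFormula ψ = φ := by
  induction φ with
  | falsum => exact ⟨0, fun m _ => ⟨.falsum, rfl⟩⟩
  | equal t₁ t₂ =>
    refine ⟨0, fun m _ => ?_⟩
    obtain ⟨s₁, rfl⟩ := exists_onTerm_eq m t₁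
    obtain ⟨s₂, rfl⟩ := exists_onTerm_eq m t₂
    exact ⟨.equal s₁ s₂, rfl⟩
  | rel s ts =>
    change H.Rel ⊤ _ at s
    choose ts' hts' using fun m i => exists_onTerm_eq m (ts i)
    cases s with
    | R => exact ⟨0, fun m _ => ⟨.rel (L := H.language m) (Rel.R : H.Rel m (r + 1)) (ts' m),
        congrArg _ (funext (hts' m))⟩⟩
    | Q η => exact ⟨η.1.length, fun m hm => ⟨.rel (L := H.language m)
        (Rel.Q ⟨η.1, η.2.1, by exact_mod_cast hm⟩ : H.Rel m 1) (ts' m),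
        congrArg _ (funext (hts' m))⟩⟩
  | imp φ₁ φ₂ ih₁ ih₂ =>
    obtain ⟨m₁, h₁⟩ := ih₁
    obtain ⟨m₂, h₂⟩ := ih₂
    refine ⟨max m₁ m₂, fun m hm => ?_⟩
    obtain ⟨ψ₁, rfl⟩ := h₁ m (le_of_max_le_left hm)
    obtain ⟨ψ₂, rfl⟩ := h₂ m (le_of_max_le_right hm)
    exact ⟨ψ₁.imp ψ₂, rfl⟩
  | all φ ih =>
    obtain ⟨m₀, h⟩ := ih
    refine ⟨m₀, fun m hm => ?_⟩
    obtain ⟨ψ, rfl⟩ := h m hm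
    exact ⟨ψ.all, rfl⟩

theorem incl_isExpansionOn {M : Type*} (C : H.ColoredHypergraph M) (m : ℕ) :
    letI := C.str m
    letI := C.str ⊤
    (H.incl m).IsExpansionOn M :=
  letI := C.str m
  letI := C.str ⊤
  { map_onFunction := fun f => Empty.elim f
    map_onRelation := fun {n} (s : H.Rel m n) => match n, s with
      | _, .R => fun _ => rfl
      | _, .Q _ => fun _ => rfl }

theorem isLimit_genericTheory (hH : H.IsAmple) (Tm : ∀ m : ℕ, (H.language m).Theory)
    (hTm : ∀ m : ℕ, IsModelCompletion.{0, 0, w} (H.baseTheory m) (Tm m)) :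
    H.IsLimit Tm (H.genericTheory ⊤) := by
  intro φ
  obtain ⟨m₀, hm₀⟩ := exists_onBoundedFormula_eq φ
  obtain ⟨l, hl⟩ := exists_hasLevel.{0, 0} hH φ
  filter_upwards [eventually_ge_atTop (max m₀ l)] with m hm
  obtain ⟨ψ, hψ⟩ := hm₀ m (le_of_max_le_left hm)
  refine ⟨ψ, hψ, ?_⟩
  obtain ⟨M₁, _, C₁, h₁⟩ := exists_isGeneric.{0} m hH
  obtain ⟨M₂, _, C₂, h₂⟩ := exists_isGeneric.{0} ⊤ hH
  let := C₁.str m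
  let := C₁.str ⊤
  let := C₂.str ⊤
  have := incl_isExpansionOn C₁ m
  have hM₁ := h₁.models
  have hM₂ := h₂.models
  have hψφ : (H.incl m).onSentence ψ = φ := hψ
  rw [theoryEquiv_of_isModelCompletion hH (hTm m) ψ,
    ← (isComplete_genericTheory hH).realize_sentence_iff ψ M₁,
    ← (isComplete_genericTheory hH).realize_sentence_iff φ M₂,
    ← (H.incl m).realize_onSentence M₁ ψ, hψφ]
  have hlm : (l : ℕ∞) ≤ m := by exact_mod_cast le_of_max_le_right hm
  exact hl.formula_realize_iff h₁ h₂ ((min_eq_right hlm).trans (min_eq_right le_top).symm)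
    ⟨isEmptyElim, isEmptyElim, fun u => (u 0).elim⟩

/-! ### Free amalgamation -/

namespace ColoredHypergraph

section Amalgam

variable {M W ι : Type*} {C : H.ColoredHypergraph M} {l : ℕ} {c : W → M}

/-- The map that embeds a copy of `M` into `M ⊕ M` in such a way that its vertices `c w` become the
vertices `d w` of the first summand, while all the others go to the second summand. -/
noncomputable def copy (c d : W → M) : M → M ⊕ M :=
  Function.extend c (Sum.inl ∘ d) Sum.inr

theorem copy_apply {d : W → M} (h : d.FactorsThrough c) (w : W) :
    copy c d (c w) = Sum.inl (d w) :=
  Function.FactorsThrough.extend_apply (fun _ _ hw => congrArg Sum.inl (h hw)) _ _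

theorem copy_apply_of_forall_ne {d : W → M} {m : M} (hm : ∀ w, c w ≠ m) :
    copy c d m = Sum.inr m :=
  Function.extend_apply' _ _ _ fun ⟨w, hw⟩ => hm w hw

theorem copy_eq_inl {d : W → M} (h : d.FactorsThrough c) {m m' : M}
    (hm : copy c d m = Sum.inl m') : ∃ w, c w = m ∧ d w = m' := by
  by_cases hc : ∃ w, c w = m
  · obtain ⟨w, rfl⟩ := hc
    exact ⟨w, rfl, Sum.inl_injective ((copy_apply h w).symm.trans hm)⟩
  · rw [copy_apply_of_forall_ne (not_exists.1 hc)] at hm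
    exact (Sum.inr_ne_inl hm).elim

theorem eq_of_copy_eq_copy {d d' : W → M} (h : d.FactorsThrough c) (h' : d'.FactorsThrough c)
    (hdd' : ∀ w w', d w = d' w' → c w = c w') {m m' : M} (hm : copy c d m = copy c d' m') :
    m = m' := by
  by_cases hc : ∃ w, c w = m
  · obtain ⟨w, rfl⟩ := hc
    rw [copy_apply h] at hm
    obtain ⟨w', rfl, hw'⟩ := copy_eq_inl h' hm.symm
    exact hdd' w w' hw'.symm
  · by_cases hc' : ∃ w, c w = m'
    · obtain ⟨w', rfl⟩ := hc'
      rw [copy_apply h'] at hm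
      obtain ⟨w, hw, -⟩ := copy_eq_inl h hm
      exact (hc ⟨w, hw⟩).elim
    · rw [copy_apply_of_forall_ne (not_exists.1 hc),
        copy_apply_of_forall_ne (not_exists.1 hc')] at hm
      exact Sum.inr_injective hm

/-- The free amalgam of `M`, embedded by `Sum.inl`, and of its copies, embedded by
`copy c (d i)`: there are no edges besides those of `M` and of the copies. The colors at the levels
from `l` on are reset to `0`, since the copies need not agree with `M` there. -/
def amalgam (hH : ∀ j, 0 < H.size j) (l : ℕ) (C : H.ColoredHypergraph M) (c : W → M)
    (d : ι → W → M) : H.ColoredHypergraph (M ⊕ M) where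
  color t j := if j < l then C.color (Sum.elim id id t) j else ⟨0, hH j⟩
  edge t := (∃ u, t = Sum.inl ∘ u ∧ C.edge u) ∨ ∃ i u, t = copy c (d i) ∘ u ∧ C.edge u

variable {hH : ∀ j, 0 < H.size j} {d : ι → W → M}

theorem Agree.factorsThrough {d : W → M} (h : Agree l C C c d) : d.FactorsThrough c :=
  fun w w' => (h.eq_iff w w').1

theorem amalgam_color_inl (m : M) {j : ℕ} (hj : j < l) :
    (amalgam hH l C c d).color (Sum.inl m) j = C.color m j :=
  if_pos hj

theorem amalgam_color_copy (hd : ∀ i, Agree l C C c (d i)) (i : ι) (m : M) {j : ℕ} (hj : j < l) :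
    (amalgam hH l C c d).color (copy c (d i) m) j = C.color m j := by
  by_cases hm : ∃ w, c w = m
  · obtain ⟨w, rfl⟩ := hm
    rw [copy_apply (hd i).factorsThrough, amalgam_color_inl _ hj, (hd i).color_eq w j hj]
  · rw [copy_apply_of_forall_ne (not_exists.1 hm)]
    exact if_pos hj

theorem edge_iff_of_copy_eq_inl {d : W → M} (hd : Agree l C C c d)
    {u u' : Fin (r + 1) → M} (h : copy c d ∘ u = Sum.inl ∘ u') : C.edge u ↔ C.edge u' := by
  choose w hw hw' using fun k => copy_eq_inl hd.factorsThrough (congrFun h k)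
  obtain rfl : c ∘ w = u := funext hw
  obtain rfl : d ∘ w = u' := funext hw'
  exact hd.edge_iff w

theorem isBase_amalgam (hC : C.IsBase N) (hd : ∀ i, Agree l C C c (d i)) :
    (amalgam hH l C c d).IsBase (min N l) where
  symm := by
    rintro σ _ (⟨u, rfl, he⟩ | ⟨i, u, rfl, he⟩)
    · exact Or.inl ⟨u ∘ σ, rfl, hC.symm σ u he⟩
    · exact Or.inr ⟨i, u ∘ σ, rfl, hC.symm σ u he⟩
  inj := by
    rintro _ (⟨u, rfl, he⟩ | ⟨i, u, rfl, he⟩)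
    · exact Sum.inl_injective.comp (hC.inj u he)
    · exact fun k k' h => hC.inj u he (eq_of_copy_eq_copy (hd i).factorsThrough
        (hd i).factorsThrough (fun w w' => ((hd i).eq_iff w w').2) h)
  compat := by
    rintro _ (⟨u, rfl, he⟩ | ⟨i, u, rfl, he⟩) j hj
    all_goals
      obtain ⟨hjN, hjl⟩ := lt_min_iff.1 hj
      convert hC.compat u he j hjN using 2
    · exact amalgam_color_inl _ (by exact_mod_cast hjl)
    · exact amalgam_color_copy hd i _ (by exact_mod_cast hjl)
  zero := by
    intro t j hj
    by_cases hjl : j < l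
    · have hjN : N ≤ j := (min_le_iff.1 hj).resolve_right (not_le.2 (by exact_mod_cast hjl))
      exact (congrArg Fin.val (if_pos hjl)).trans (hC.zero _ j hjN)
    · exact congrArg Fin.val (if_neg hjl)

theorem agree_amalgam_inl (hd : ∀ i, Agree l C C c (d i)) :
    Agree l (amalgam hH l C c d) C Sum.inl id where
  eq_iff _ _ := Sum.inl_injective.eq_iff
  color_eq m _ hj := amalgam_color_inl m hj
  edge_iff u := by
    refine ⟨?_, fun he => Or.inl ⟨u, rfl, he⟩⟩
    rintro (⟨u', h, he⟩ | ⟨i, u', h, he⟩)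
    · rwa [Sum.inl_injective.comp_left h]
    · exact (edge_iff_of_copy_eq_inl (hd i) h.symm).1 he

theorem agree_amalgam_copy (hd : ∀ i, Agree l C C c (d i))
    (hdelta : ∀ i i' w w', d i w = d i' w' → c w = c w') (i : ι) :
    Agree l C (amalgam hH l C c d) id (copy c (d i)) where
  eq_iff _ _ := ⟨congrArg _, eq_of_copy_eq_copy (hd i).factorsThrough (hd i).factorsThrough
    (hdelta i i)⟩
  color_eq m _ hj := (amalgam_color_copy hd i m hj).symm
  edge_iff u := by
    refine ⟨fun he => Or.inr ⟨i, u, rfl, he⟩, ?_⟩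
    rintro (⟨u', h, he⟩ | ⟨i', u', h, he⟩)
    · exact (edge_iff_of_copy_eq_inl (hd i) h).2 he
    · rwa [show id ∘ u = u' from funext fun k => eq_of_copy_eq_copy (hd i).factorsThrough
        (hd i').factorsThrough (hdelta i i') (congrFun h k)]

theorem IsGeneric.exists_forall_agree [Finite ι] {V : Type*} [Finite V] {a : ℕ}
    (hC : C.IsGeneric N) (hH : ∀ j, 0 < H.size j) (hd : ∀ i, Agree l C C c (d i))
    (hdelta : ∀ i i' w w', d i w = d i' w' → c w = c w') (p : V → W) {x : Fin a → M}
    (hx : ∀ i k w, c w = x k → d i w = c w) (hl : H.HasJoins ⊤ l (Nat.card (ι × V) + a)) :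
    ∃ y : Fin a → M, ∀ i, Agree l C C (Sum.elim x (c ∘ p)) (Sum.elim y (d i ∘ p)) := by
  have copy_x_eq (i : ι) (k : Fin a) : copy c (d i) (x k) = copy c c (x k) := by
    by_cases hxc : ∃ w, c w = x k
    · obtain ⟨w, hw⟩ := hxc
      rw [← hw, copy_apply (hd i).factorsThrough, copy_apply fun _ _ h => h, hx i k w hw]
    · rw [copy_apply_of_forall_ne (not_exists.1 hxc), copy_apply_of_forall_ne (not_exists.1 hxc)]
  obtain ⟨y, hy⟩ := hC.exists_agree_sum (isBase_amalgam (hH := hH) hC.toIsBase hd) (by simp)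
    ((agree_amalgam_inl hd).comp fun s : ι × V => d s.1 (p s.2)) hl fun k => copy c c (x k)
  refine ⟨y, fun i => ?_⟩
  have hy_i : Agree l (amalgam hH l C c d) C (copy c (d i) ∘ Sum.elim x (c ∘ p))
      (Sum.elim y (d i ∘ p)) := by
    convert hy.comp (Sum.elim Sum.inr fun v => Sum.inl (i, v)) using 1 <;> ext (k | v) : 1
    · exact copy_x_eq i k
    · exact copy_apply (hd i).factorsThrough (p v)
    · rfl
    · rfl
  exact ((agree_amalgam_copy hd hdelta i).comp _).trans hy_i

end Amalgam

theorem exists_realize_of_agree (hH : H.IsAmple) {a b : ℕ}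
    (φ : (H.language N).Formula (Fin a ⊕ Fin b)) (q : ℕ) :
    ∃ l : ℕ, ∀ {M : Type w} {C : H.ColoredHypergraph M} {W : Type v} [Finite W] {p : Fin b → W}
      {x : Fin a → M} {c : W → M} {d : ℕ → W → M} {I : Set ℕ}, C.IsGeneric N → I.Infinite →
      (∀ i ∈ I, Agree l C C c (d i)) → (∀ i ∈ I, ∀ k w, c w = x k → d i w = c w) →
      letI := C.str N
      φ.Realize (Sum.elim x (c ∘ p)) →
      ∃ s : Finset ℕ, s.card = q ∧ ∃ y : Fin a → M, ∀ i ∈ s, φ.Realize (Sum.elim y (d i ∘ p)) := by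
  obtain ⟨l₀, hl₀⟩ := exists_hasLevel.{w, w} hH φ
  obtain ⟨l₁, hl₁⟩ := hH.exists_hasJoins (q * b + a)
  refine ⟨max l₀ l₁, fun {M C W _ p x c d I} hC hI hd hx hφ => ?_⟩
  obtain ⟨J, hJI, hJ, hJd⟩ := exists_infinite_deltaSystem hI d
  obtain ⟨s, hsJ, rfl⟩ := hJ.exists_subset_card_eq q
  have hdelta (i i' : s) (w w' : W) (h : d i w = d i' w') : c w = c w' := by
    by_cases hii : i = i'
    · subst hii
      exact ((hd i (hJI (hsJ i.2))).eq_iff w w').2 h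
    · rcases hJd i (hsJ i.2) i' (hsJ i'.2) (Subtype.coe_ne_coe.2 hii) w w' h with h | h
      · exact ((hd i' (hJI (hsJ i'.2))).eq_iff w w').2 h
      · exact ((hd i (hJI (hsJ i.2))).eq_iff w w').2 h
  obtain ⟨y, hy⟩ := hC.exists_forall_agree hH.size_pos (fun i : s => hd i (hJI (hsJ i.2))) hdelta p
    (fun i : s => hx i (hJI (hsJ i.2))) (hl₁.mono le_rfl (le_max_right l₀ l₁) (by simp))
  exact ⟨s, rfl, y, fun i hi => (hl₀.formula_realize_iff hC hC rfl
    ((hy ⟨i, hi⟩).mono (le_max_left l₀ l₁))).1 hφ⟩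

end ColoredHypergraph

/-! ### Simplicity and rank -/

theorem ColoredHypergraph.exists_infinite_agree {M V : Type*} [Finite V]
    (C : H.ColoredHypergraph M) (l : ℕ) (c : ℕ → V → M) :
    ∃ i₀, {i | Agree l C C (c i₀) (c i)}.Infinite := by
  let profile (i : ℕ) : Set (V × V) × (V → ∀ j : Fin l, Fin (H.size j)) × Set (Fin (r + 1) → V) :=
    ({s | c i s.1 = c i s.2}, fun s j => C.color (c i s) j, {u | C.edge (c i ∘ u)})
  obtain ⟨y, hy⟩ := Finite.exists_infinite_fiber profile
  rw [Set.infinite_coe_iff] at hy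
  obtain ⟨i₀, hi₀⟩ := hy.nonempty
  refine ⟨i₀, hy.mono fun i hi => ?_⟩
  obtain ⟨heq, hcolor, hedge⟩ : _ ∧ _ ∧ _ := by
    simpa only [profile, Prod.mk.injEq] using hi₀.trans hi.symm
  exact ⟨fun s s' => Set.ext_iff.1 heq (s, s'),
    fun s j hj => congrFun (congrFun hcolor s) ⟨j, hj⟩, fun u => Set.ext_iff.1 hedge u⟩

theorem isSimpleTheory_genericTheory (hH : H.IsAmple) :
    IsSimpleTheory.{0, 0, w} (H.genericTheory N) := by
  rintro a b φ ⟨@⟨M, _, hM, _⟩, p, q, hinc, hcons⟩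
  obtain ⟨C, hC, rfl⟩ := exists_isGeneric_of_models hH hM
  obtain ⟨l, hl⟩ := exists_realize_of_agree.{w, w} hH φ q
  have (η : List ℕ) : Finite (prefixParams p η) := finite_prefixParams p η
  let tuple (η : List ℕ) (i : ℕ) : prefixParams p η ⊕ Fin b → M := Sum.elim (↑) (p (η ++ [i]))
  choose next hnext using fun η => C.exists_infinite_agree l (tuple η)
  obtain ⟨x, hx⟩ := hcons (fun j => next (treePath next j)) (a + 1)
  simp only [ofFn_next_treePath] at hx
  obtain ⟨j, hj, hxj⟩ := exists_forall_mem_prefixParams (next := next) p x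
  set η := treePath next j
  have htuple (i : ℕ) (hi : Agree l C C (tuple η (next η)) (tuple η i)) (k : Fin a)
      (w : prefixParams p η ⊕ Fin b) (hw : tuple η (next η) w = x k) :
      tuple η i w = tuple η (next η) w := by
    rcases w with m | t
    · rfl
    · let m : prefixParams p η := ⟨x k, hxj k t hw.symm⟩
      exact ((hi.eq_iff (Sum.inr t) (Sum.inl m)).1 hw).trans hw.symm
  obtain ⟨s, hs, y, hy⟩ := hl (p := Sum.inr) hC (hnext η) (fun i hi => hi) htuple (hx j hj)
  exact hinc η s hs ⟨y, hy⟩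

theorem not_divides_of_forall_ne (hH : H.IsAmple) {M : Type w} [(H.language N).Structure M]
    (hM : M ⊨ H.genericTheory N) {a b : ℕ} {A : Set M} {φ : (H.language N).Formula (Fin a ⊕ Fin b)}
    {d : Fin b → M} {x : Fin a → M} (hx : ∀ k p, x k ≠ d p) (hφ : φ.Realize (Sum.elim x d)) :
    ¬ (H.language N).Divides A φ d := by
  rintro ⟨M', _, g, q, c, hc, hinc⟩
  obtain ⟨C, hC, rfl⟩ := exists_isGeneric_of_models hH ((g.theory_model_iff _).1 hM)
  obtain ⟨l, hl⟩ := exists_realize_of_agree.{0, w} hH φ q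
  let := C.str N
  have hagree (i : ℕ) : Agree l C C (g ∘ d) (c i) :=
    agree_of_realize_isQF hC.toIsBase hC.toIsBase (fun θ _ hθ => by
      simpa only [Formula.realize_relabel, Sum.elim_comp_inr] using
        (hc i (θ.relabel Sum.inr)).2 (by simpa only [Formula.realize_relabel, Sum.elim_comp_inr])) l
  have hgφ := (g.map_formula φ (Sum.elim x d)).2 hφ
  rw [Sum.comp_elim] at hgφ
  obtain ⟨s, hs, y, hy⟩ := hl (p := id) hC Set.infinite_univ (fun i _ => hagree i)
    (fun _ _ k p h => absurd (g.injective h.symm) (hx k p)) hgφ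
  exact hinc s hs ⟨y, hy⟩

theorem mem_of_typeForks (hH : H.IsAmple) {M : Type w} [(H.language N).Structure M]
    (hM : M ⊨ H.genericTheory N) {A B : Set M} {c : M} (h : (H.language N).TypeForks A B c) :
    c ∈ B := by
  classical
  by_contra hcB
  obtain ⟨b, φ, d, hd, hφ, M', _, g, n, b', ψ, e, hdiv, hcov⟩ := h
  have hM' := (g.theory_model_iff (H.genericTheory N)).1 hM
  obtain ⟨C', hC', hS'⟩ := exists_isGeneric_of_models hH hM'
  obtain ⟨C, hC, rfl⟩ := exists_isGeneric_of_models hH hM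
  subst hS'
  let := C.str N
  let := C'.str N
  let F : Finset M' :=
    Finset.univ.image (g ∘ d) ∪ Finset.univ.biUnion fun j => Finset.univ.image (e j)
  obtain ⟨l, hl⟩ := exists_hasLevel.{w, w} hH φ
  obtain ⟨l', hl'⟩ := hH.exists_hasJoins F.card
  have hagree : Agree (max l l') C C' d (g ∘ d) :=
    agree_of_realize_isQF hC.toIsBase hC'.toIsBase (fun θ _ => (g.map_formula θ d).2) _
  obtain ⟨y, hyF, hy⟩ := hC'.exists_agree_option_notMem hC.toIsBase rfl hagree (F := F)
    (fun i => Finset.mem_union_left _ (Finset.mem_image_of_mem _ (Finset.mem_univ i)))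
    (hl'.mono le_rfl (le_max_right l l') le_rfl) (x := c) fun i hi => hcB (hi ▸ hd i)
  have hφy : φ.Realize (Sum.elim (fun _ : Fin 1 => y) (g ∘ d)) := by
    refine (hl.formula_realize_iff hC hC' rfl ?_).1 hφ
    convert (hy.mono (le_max_left l l')).comp (Sum.elim (fun _ : Fin 1 => none) some) using 1 <;>
      ext (k | i) <;> rfl
  obtain ⟨j, hj⟩ := hcov _ hφy
  refine not_divides_of_forall_ne hH hM' (fun _ p hp => hyF ?_) hj (hdiv j)
  exact Finset.mem_union_right _ (Finset.mem_biUnion.2 ⟨j, Finset.mem_univ j,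
    hp ▸ Finset.mem_image_of_mem _ (Finset.mem_univ p)⟩)

theorem exists_suRankGE_one (hH : H.IsAmple) :
    ∃ (M : Theory.ModelType.{0, 0, w} (H.genericTheory N)) (c : M),
      (H.language N).SURankGE 1 M ∅ c := by
  let C₀ := discreteHypergraph hH.size_pos (ULift.{w} ℕ)
  have hC₀ : C₀.IsBase N := isBase_discreteHypergraph hH.size_pos _
  let C := GenericExt.coloredHypergraph N C₀
  have hC : C.IsGeneric N := GenericExt.isGeneric hH hC₀
  let := C.str N
  let c (i : ℕ) : H.GenericExt N (ULift.{w} ℕ) := .base ⟨i⟩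
  have : Nonempty (H.GenericExt N (ULift.{w} ℕ)) := ⟨c 0⟩
  have hc : Function.Injective c := fun i j h => ULift.up_injective (GenericExt.base_injective h)
  have hagree (i l : ℕ) : Agree l C C (fun _ : Fin 1 => c i) fun _ => c 0 :=
    ⟨fun _ _ => iff_of_true rfl rfl, fun _ _ _ => rfl, fun _ => iff_of_false
      (GenericExt.edge_base_iff hC₀ fun _ => ⟨i⟩).1 (GenericExt.edge_base_iff hC₀ fun _ => ⟨0⟩).1⟩
  refine ⟨hC.models.bundled, c 0, suRankGE_one_of_divides_eqFormula (divides_eqFormula hc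
    fun i θ => realize_iff_of_agree hH θ hC hC fun l => ?_)⟩
  convert (hagree i l).comp (Sum.elim (fun m : (∅ : Set _) => m.2.elim) id) using 1 <;>
    ext (m | k) <;> first | exact m.2.elim | rfl

end HypergraphSeq

open HypergraphSeq in
theorem mainTheorem1_general (r : ℕ) (H : HypergraphSeq r) (hH : H.IsAmple) :
    ∃ T : (H.language ⊤).Theory,
      IsModelCompletion.{0, 0, w} (H.baseTheory ⊤) T ∧
      (∀ T' : (H.language ⊤).Theory,
        IsModelCompletion.{0, 0, w} (H.baseTheory ⊤) T' → TheoryEquiv T' T) ∧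
      EliminatesQuantifiers T ∧
      IsSimpleTheory.{0, 0, w} T ∧
      HasSURank.{0, 0, w} T 1 ∧
      (∀ m : ℕ, ∃ S : (H.language m).Theory,
        IsModelCompletion.{0, 0, w} (H.baseTheory m) S) ∧
      ∀ Tm : ∀ m : ℕ, (H.language m).Theory,
        (∀ m : ℕ, IsModelCompletion.{0, 0, w} (H.baseTheory m) (Tm m)) →
          H.IsLimit Tm T :=
  have not_suRankGE_two (M : Theory.ModelType.{0, 0, w} (H.genericTheory ⊤)) (c : M) :
      ¬ (H.language ⊤).SURankGE 2 M ∅ c :=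
    not_suRankGE_two_of_forall_typeForks M.is_model
      (fun _ _ hM' _ _ _ => mem_of_typeForks hH hM') ∅ c
  ⟨H.genericTheory ⊤, isModelCompletion_genericTheory hH,
    fun _ => theoryEquiv_of_isModelCompletion hH, eliminatesQuantifiers_genericTheory hH,
    isSimpleTheory_genericTheory hH, ⟨exists_suRankGE_one hH, not_suRankGE_two⟩,
    fun m => ⟨H.genericTheory m, isModelCompletion_genericTheory hH⟩,
    isLimit_genericTheory hH⟩

theorem mainTheorem1 (r : ℕ) (H : HypergraphSeq r) (hH : H.IsTemplate) :
    ∃ T : (H.language ⊤).Theory,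
      FirstOrder.Language.IsModelCompletion.{0, 0, w} (H.baseTheory ⊤) T ∧
      (∀ T' : (H.language ⊤).Theory,
        FirstOrder.Language.IsModelCompletion.{0, 0, w} (H.baseTheory ⊤) T' → FirstOrder.Language.TheoryEquiv T' T) ∧
      FirstOrder.Language.EliminatesQuantifiers T ∧
      FirstOrder.Language.IsSimpleTheory.{0, 0, w} T ∧
      FirstOrder.Language.HasSURank.{0, 0, w} T 1 ∧
      (∀ m : ℕ, ∃ S : (H.language m).Theory,
        FirstOrder.Language.IsModelCompletion.{0, 0, w} (H.baseTheory m) S) ∧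
      ∀ Tm : ∀ m : ℕ, (H.language m).Theory,
        (∀ m : ℕ, FirstOrder.Language.IsModelCompletion.{0, 0, w} (H.baseTheory m) (Tm m)) →
          H.IsLimit Tm T :=
  mainTheorem1_general r H hH.isAmple
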